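/- Let $J\ge 1$, let $a_1>0$, $a_2\ge 0,\dots,a_{J-1}\ge 0$, $a_J>0$ be known constants, and let $\lambda,C,C_0>0$ and $p>1/2$. Put $c_j^2:=2\,(2(2j-1))!/(2j-1)!$ with $c_j>0$ for $1<j\le J$, and assume that $$C_1:=\lambda^{1/2}\Big(1-\sum_{1<j\le J}\frac{2j\,c_j\,a_j}{\lambda^{j}}\Big)>0,\qquad C_2:=2a_1-\lambda>0 .$$ Let $\mathcal F=\mathcal F_{p,C,C_0,\boldsymbol a,\lambda}$ be the class of all even, twice continuously differentiable functions $f:\mathbb R\to\mathbb R$ with $f,f',f''$ bounded such that $$\|f\|_\infty\le C_0,\qquad \|f'\|_\infty\le C_1,\qquad \inf_{y\in\mathbb R} f''(y)\ge -C_2,\qquad \limsup_{y\to\infty}\, y^{2p}\int_y^\infty |f'(u)|^2\,du\le C .$$ For $\beta\in\mathcal F$ let $\Pi_\beta$ be the probability measure on $\mathbb R$ whose Lebesgue density $\pi_\beta$ is the even probability density that solves $$\pi_\beta(y)=Z_{\pi_\beta}^{-1}\exp\big(-(\varphi\star\pi_\beta)(y)\big),\quad y\in\mathbb R,\qquad Z_{\pi_\beta}=\int_{\mathbb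 R}\exp\big(-(\varphi\star\pi_\beta)(y)\big)\,dy,$$ where $\varphi(y)=\sum_{j=1}^J a_j y^{2j}+\beta(y)$ and $(\varphi\star\pi)(y)=\int_{\mathbb R}\varphi(y-x)\pi(x)\,dx$. Then there are constants $c_0>0$ and $\delta>0$, depending only on $p,C,C_0,\boldsymbol a,\lambda$, such that for every $N\ge 2$ $$\inf_{\beta'_N}\ \sup_{\beta\in\mathcal F}\ \Pi_\beta^{\otimes N}\Big(\|\beta'_N-\beta'\|_{L^2(\mathbb R)}^2>c_0(\log N)^{-p/J}\Big)\ \ge\ \delta ,$$ where the infimum is over all estimators of $\beta'$ based on $N$ i.i.d. observations, that is, over all jointly measurable maps $(Y,x)\mapsto\beta'_N(Y)(x)$ from $\mathbb R^N\times\mathbb R$ to $\mathbb R$ (the loss being $+\infty$ if $\beta'_N(Y)-\beta'\notin L^2(\mathbb R)$). More precisely, for every $N\ge2$ and every estimator the supremum is bounded below by $\delta$ through some $\beta\in\mathcal F$ for which the even solution $\pi_\beta$ exists and is unique. -/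

import Mathlib

open MeasureTheory Filter Finset
open scoped ENNReal

namespace McKeanVlasov

/-- The interaction potential `φ(y) = ∑_{j=1}^J a_j y^{2j} + β(y)`. -/
noncomputable def potential (J : ℕ) (a : ℕ → ℝ) (β : ℝ → ℝ) (y : ℝ) : ℝ :=
  ∑ j ∈ Icc 1 J, a j * y ^ (2 * j) + β y

/-- The convolution `(φ ⋆ π)(y) = ∫ φ(y - x) π(x) dx`. -/
noncomputable def conv (φ π : ℝ → ℝ) : ℝ → ℝ :=
  convolution π φ (ContinuousLinearMap.mul ℝ ℝ) volume

/-- `π` is the (symmetric) invariant density for the interaction potential `φ`: an even probability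
density with `π(y) = Z⁻¹ exp(-(φ ⋆ π)(y))` for all `y`, `Z = ∫ exp(-(φ ⋆ π)(y)) dy`.
Since every translate of a solution of this equation is again a solution, the symmetry
selects one solution from each family of translates. -/
structure IsInvariantDensity (φ π : ℝ → ℝ) : Prop where
  nonneg : ∀ y, 0 ≤ π y
  integrable : Integrable π volume
  integral_eq_one : ∫ y, π y = 1
  even : Function.Even π
  conv_exists : ConvolutionExists π φ (ContinuousLinearMap.mul ℝ ℝ) volume
  exp_integrable : Integrable (fun y => Real.exp (-conv φ π y)) volume
  self_consistent : ∀ y, π y = (∫ z, Real.exp (-conv φ π z))⁻¹ * Real.exp (-conv φ π y)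

/-- The probability law on `ℝ` with Lebesgue density `π`. -/
noncomputable def law (π : ℝ → ℝ) : Measure ℝ :=
  volume.withDensity fun y => ENNReal.ofReal (π y)

/-- `c_j`, with `c_j ^ 2 = 2 (2(2j-1))! / (2j-1)!`, used for `j ≥ 2` only. -/
noncomputable def cCoef (j : ℕ) : ℝ :=
  Real.sqrt (2 * (Nat.factorial (2 * (2 * j - 1)) : ℝ) / (Nat.factorial (2 * j - 1) : ℝ))

/-- `C₁ = λ^{1/2} (1 - ∑_{1 < j ≤ J} 2 j c_j a_j / λ^j)`. -/
noncomputable def C₁ (J : ℕ) (a : ℕ → ℝ) (lam : ℝ) : ℝ :=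
  Real.sqrt lam * (1 - ∑ j ∈ Icc 2 J, 2 * (j : ℝ) * cCoef j * a j / lam ^ j)

/-- `C₂ = 2 a₁ - λ`. -/
def C₂ (a : ℕ → ℝ) (lam : ℝ) : ℝ := 2 * a 1 - lam

/-- The class of nonparametric components: even `f ∈ C_b²(ℝ)` with
`‖f‖_∞ ≤ C₀`, `‖f'‖_∞ ≤ C₁`, `inf f'' ≥ -C₂` and
`limsup_{y → ∞} y^{2p} ∫_y^∞ |f'(u)|² du ≤ C`.
The limit superior is taken in `[0, ∞]`. -/
structure InClass (J : ℕ) (a : ℕ → ℝ) (p C C₀ lam : ℝ) (f : ℝ → ℝ) : Prop where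
  contDiff : ContDiff ℝ 2 f
  even : Function.Even f
  bound_zero : ∀ y, |f y| ≤ C₀
  bound_one : ∀ y, |deriv f y| ≤ C₁ J a lam
  bounded_two : ∃ B, ∀ y, |iteratedDeriv 2 f y| ≤ B
  lower_two : ∀ y, -C₂ a lam ≤ iteratedDeriv 2 f y
  tail : limsup (fun y : ℝ => ENNReal.ofReal (y ^ (2 * p)) *
      ∫⁻ u in Set.Ioi y, ENNReal.ofReal (|deriv f u| ^ 2)) atTop ≤ ENNReal.ofReal C

end McKeanVlasov

/-! Le Cam's two-point method, with `β = 0` against an even pair of bumps centred at `R` and `-R`,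
of height `s₀ R^(-p)`. Invariant densities are bounded by a constant times `exp(-a_J x^(2J))` away
from the origin, so when `R^(2J)` is a large multiple of `log N` the observations carry almost no
information about what happens near `±R`. The two invariant laws then have squared Hellinger
distance at most `1/(4N²)`, and `N` observations cannot tell them apart, whereas the two derivatives
differ in squared `L²` norm by at least a multiple of `R^(-2p)`, that is, of `(log N)^(-p/J)`. The
height `R^(-p)` keeps `y^(2p) ∫_y^∞ |β'|²` below `C` for every `y ≥ 0`. Compact support alone would
already make the limsup vanish for each fixed `R`, but the bound obtained is uniform in `N`.

The invariant density depends on `β` through a fixed-point equation, so the remoteness of the bumps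
has to be carried through the fixed point. This is done by showing that the Gibbs map contracts the
squared Hellinger distance by a factor `κ < 1` (`hell_gibbs_le`), which rests on three facts. The
class `GaussDecay` is preserved by the map: the lower bound on `β''` leaves curvature `2 a₁ - C₂ =
lam`. On this class a Hardy inequality with constant `1/lam` holds, and with it Gaussian bounds on
all even moments. If `log p - log q = W + const`, then `hell p q ≤ (1/8) ∫ (p + q) W²`, because the
constant integrates to zero against `p - q` (`hell_le_of_log_sub`). For two Gibbs densities, `W` is
the integral of `μ₁ - μ₀` against increments of `φ`. The quadratic part of `φ` drops out because the
densities are centred; Cauchy-Schwarz and the Hardy inequality bound the rest by the energy `E g(X -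
Y)²` of the non-linear force `g`. Gaussian moments bound this energy by `lam κ`
(`contractive_potential`), and `C₁ > 0` says precisely that the polynomial part contributes a rate
below one.

Contraction yields existence and uniqueness of the invariant density. It also yields stability: the
distance between two fixed points is controlled by the effect of the perturbation on a single
density, hence by the tail mass beyond half the distance to the bumps (`hell_le_tailMass`). The
super-Gaussian tail bound and `quarter_le_law_pi` then conclude. -/

namespace McKeanVlasov

/-! ### Gaussian decay and a Hardy-type inequality. -/

/-- Even probability densities that decay at least like a centred Gaussian of variance `1 / lam`
when moving away from the origin. -/
structure GaussDecay (lam : ℝ) (p : ℝ → ℝ) : Prop where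
  nonneg : ∀ y, 0 ≤ p y
  integrable : Integrable p volume
  integral_eq_one : ∫ y, p y = 1
  even : Function.Even p
  decay : ∀ u x, 0 ≤ u → u ≤ x → p x ≤ p u * Real.exp (-(lam / 2) * (x ^ 2 - u ^ 2))

theorem integral_Ioi_mul_exp_neg_mul_sq {b : ℝ} (hb : 0 < b) {s : ℝ} (hs : 0 ≤ s) :
    ∫⁻ x in Set.Ioi s, ENNReal.ofReal (x * Real.exp (-b * (x ^ 2 - s ^ 2))) =
      ENNReal.ofReal (1 / (2 * b)) := by
  have hder : ∀ x ∈ Set.Ici s, HasDerivAt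
      (fun x : ℝ => -(1 / (2 * b)) * Real.exp (-b * (x ^ 2 - s ^ 2)))
      (x * Real.exp (-b * (x ^ 2 - s ^ 2))) x := by
    intro x _
    have h1 : HasDerivAt (fun x : ℝ => -b * (x ^ 2 - s ^ 2)) (-b * (2 * x)) x := by
      simpa using (((hasDerivAt_pow 2 x).sub_const (s ^ 2)).const_mul (-b))
    refine (h1.exp.const_mul (-(1 / (2 * b)))).congr_deriv ?_
    generalize Real.exp _ = E
    have := hb.ne'
    field_simp
  have hpos : ∀ x ∈ Set.Ioi s, 0 ≤ x * Real.exp (-b * (x ^ 2 - s ^ 2)) := fun x hx =>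
    mul_nonneg (hs.trans (le_of_lt hx)) (Real.exp_pos _).le
  have hlim : Tendsto (fun x : ℝ => -(1 / (2 * b)) * Real.exp (-b * (x ^ 2 - s ^ 2)))
      atTop (nhds 0) := by
    have h1 : Tendsto (fun x : ℝ => -b * (x ^ 2 - s ^ 2)) atTop atBot := by
      apply Tendsto.const_mul_atTop_of_neg (by linarith)
      exact tendsto_atTop_add_const_right _ _ (tendsto_pow_atTop two_ne_zero)
    simpa using (Real.tendsto_exp_atBot.comp h1).const_mul (-(1 / (2 * b)))
  have hint := integrableOn_Ioi_deriv_of_nonneg' hder hpos hlim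
  rw [← ofReal_integral_eq_lintegral_ofReal hint
    ((ae_restrict_iff' measurableSet_Ioi).2 (Eventually.of_forall hpos)),
    integral_Ioi_of_hasDerivAt_of_nonneg' hder hpos hlim]
  simp

namespace GaussDecay

variable {lam : ℝ} {p : ℝ → ℝ}

theorem aemeasurable_ofReal (hp : GaussDecay lam p) :
    AEMeasurable (fun x => ENNReal.ofReal (p x)) volume :=
  hp.integrable.aemeasurable.ennreal_ofReal

/-- The kernel estimate for the Hardy inequality. For `s ≥ 0` the decay condition compares `p x`
with `p s` beyond `s`, and `x exp(-(lam/2)(x² - s²))` integrates over `(s, ∞)` to exactly `1/lam`.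
Negative `s` follows by reflection. -/
theorem lintegral_tail_le (hp : GaussDecay lam p) (hlam : 0 < lam) {s : ℝ} :
    ∫⁻ x, ENNReal.ofReal (p x) * (ENNReal.ofReal |x| *
      (Set.uIoc 0 x).indicator (fun _ => 1) s) ≤ ENNReal.ofReal lam⁻¹ * ENNReal.ofReal (p s) := by
  have key : ∀ s : ℝ, 0 ≤ s → ∫⁻ x in Set.Ioi s, ENNReal.ofReal (p x) * ENNReal.ofReal |x| ≤
      ENNReal.ofReal lam⁻¹ * ENNReal.ofReal (p s) := by
    intro s hs
    calc ∫⁻ x in Set.Ioi s, ENNReal.ofReal (p x) * ENNReal.ofReal |x|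
        ≤ ∫⁻ x in Set.Ioi s, ENNReal.ofReal (p s) *
            ENNReal.ofReal (x * Real.exp (-(lam / 2) * (x ^ 2 - s ^ 2))) := by
          refine setLIntegral_mono' measurableSet_Ioi fun x hx => ?_
          have hx0 : 0 ≤ x := hs.trans (le_of_lt hx)
          rw [← ENNReal.ofReal_mul (hp.nonneg _), ← ENNReal.ofReal_mul (hp.nonneg _),
            abs_of_nonneg hx0]
          apply ENNReal.ofReal_le_ofReal
          calc p x * x ≤ p s * Real.exp (-(lam / 2) * (x ^ 2 - s ^ 2)) * x := by
                gcongr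
                exact hp.decay s x hs (le_of_lt hx)
            _ = _ := by ring
      _ = ENNReal.ofReal lam⁻¹ * ENNReal.ofReal (p s) := by
          rw [lintegral_const_mul _ (by fun_prop),
            integral_Ioi_mul_exp_neg_mul_sq (half_pos hlam) hs, mul_comm]
          congr 2
          field_simp
  have hval : ∀ t x : ℝ, ENNReal.ofReal (p x) * (ENNReal.ofReal |x| *
      (Set.uIoc 0 x).indicator (fun _ => 1) t) = {x | t ∈ Set.uIoc 0 x}.indicator
        (fun x => ENNReal.ofReal (p x) * ENNReal.ofReal |x|) x := by
    intro t x
    by_cases h : t ∈ Set.uIoc 0 x <;> simp [Set.indicator, h]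
  simp_rw [hval]
  rcases lt_or_ge 0 s with hs | hs
  · have hset : {x : ℝ | s ∈ Set.uIoc 0 x} = Set.Ici s := by
      ext x
      simp only [Set.mem_uIoc, Set.mem_ofPred_eq, Set.mem_Ici]
      constructor
      · rintro (h | h)
        · exact h.2
        · linarith
      · exact fun h => Or.inl ⟨hs, h⟩
    rw [hset, lintegral_indicator measurableSet_Ici, setLIntegral_congr Ioi_ae_eq_Ici.symm]
    exact key s hs.le
  · have hset : {x : ℝ | s ∈ Set.uIoc 0 x} = Set.Iio s := by
      ext x
      simp only [Set.mem_uIoc, Set.mem_ofPred_eq, Set.mem_Iio]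
      constructor
      · rintro (h | h)
        · linarith
        · exact h.1
      · exact fun h => Or.inr ⟨h, hs⟩
    rw [hset, lintegral_indicator measurableSet_Iio, ← hp.even s]
    refine le_trans (le_of_eq ?_) (key (-s) (by linarith))
    rw [← lintegral_indicator measurableSet_Iio, ← lintegral_indicator measurableSet_Ioi,
      ← lintegral_neg_eq_self]
    congr 1
    ext x
    by_cases h : -x < s
    · have h' : -s < x := by linarith
      simp [Set.indicator, h, h', hp.even x]
    · have h' : ¬ -s < x := by linarith
      simp [Set.indicator, h, h']

/-- A weighted Hardy-type inequality behind the Poincaré inequality and the moment recursion. -/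
theorem lintegral_mul_abs_mul_setLIntegral_le (hp : GaussDecay lam p) (hlam : 0 < lam)
    {F : ℝ → ℝ≥0∞} (hF : Measurable F) :
    ∫⁻ x, ENNReal.ofReal (p x) * (ENNReal.ofReal |x| * ∫⁻ s in Set.uIoc 0 x, F s) ≤
      ENNReal.ofReal lam⁻¹ * ∫⁻ s, ENNReal.ofReal (p s) * F s := by
  have hmeas : MeasurableSet {z : ℝ × ℝ | z.2 ∈ Set.uIoc 0 z.1} := by
    simp only [Set.mem_uIoc]
    exact (((measurableSet_lt measurable_const measurable_snd).inter
      (measurableSet_le measurable_snd measurable_fst)).union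
      ((measurableSet_lt measurable_fst measurable_snd).inter
      (measurableSet_le measurable_snd measurable_const)))
  have hind : Measurable fun z : ℝ × ℝ =>
      (Set.uIoc 0 z.1).indicator (fun _ => (1 : ℝ≥0∞)) z.2 := by
    have : (fun z : ℝ × ℝ => (Set.uIoc 0 z.1).indicator (fun _ => (1 : ℝ≥0∞)) z.2) =
        {z : ℝ × ℝ | z.2 ∈ Set.uIoc 0 z.1}.indicator fun _ => 1 := by
      ext z
      simp [Set.indicator]
    rw [this]
    exact measurable_const.indicator hmeas
  have h1 : ∀ x : ℝ, ENNReal.ofReal (p x) * (ENNReal.ofReal |x| * ∫⁻ s in Set.uIoc 0 x, F s) =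
      ∫⁻ s, F s * (ENNReal.ofReal (p x) * (ENNReal.ofReal |x| *
        (Set.uIoc 0 x).indicator (fun _ => 1) s)) := by
    intro x
    have hi : Measurable ((Set.uIoc 0 x).indicator fun _ : ℝ => (1 : ℝ≥0∞)) :=
      measurable_const.indicator measurableSet_uIoc
    rw [← lintegral_indicator measurableSet_uIoc, ← mul_assoc,
      ← lintegral_const_mul _ (hF.indicator measurableSet_uIoc)]
    congr 1
    ext s
    by_cases h : s ∈ Set.uIoc 0 x
    · simp only [Set.indicator, h, if_true]
      ring
    · simp [Set.indicator, h]
  simp_rw [h1]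
  -- Tonelli: the inner integral over `x` is now the kernel estimated in `lintegral_tail_le`.
  rw [lintegral_lintegral_swap]
  · have h2 : ∀ s, ∫⁻ x, F s * (ENNReal.ofReal (p x) * (ENNReal.ofReal |x| *
        (Set.uIoc 0 x).indicator (fun _ => 1) s)) ≤
        ENNReal.ofReal lam⁻¹ * (ENNReal.ofReal (p s) * F s) := by
      intro s
      have hi : Measurable fun x : ℝ => (Set.uIoc 0 x).indicator (fun _ => (1 : ℝ≥0∞)) s :=
        hind.comp (measurable_id.prodMk measurable_const)
      have hm : AEMeasurable (fun x : ℝ => ENNReal.ofReal (p x) * (ENNReal.ofReal |x| *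
          (Set.uIoc 0 x).indicator (fun _ => 1) s)) volume :=
        hp.aemeasurable_ofReal.mul (((measurable_id.abs.ennreal_ofReal).mul hi).aemeasurable)
      rw [lintegral_const_mul'' _ hm]
      calc _ ≤ F s * (ENNReal.ofReal lam⁻¹ * ENNReal.ofReal (p s)) := by
            gcongr
            exact hp.lintegral_tail_le hlam
        _ = _ := by ring
    refine (lintegral_mono h2).trans (le_of_eq ?_)
    rw [lintegral_const_mul' _ _ ENNReal.ofReal_ne_top]
  · exact (hF.comp measurable_snd).aemeasurable.mul
      ((hp.aemeasurable_ofReal.comp_quasiMeasurePreserving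
        Measure.quasiMeasurePreserving_fst).mul
      ((measurable_fst.abs.ennreal_ofReal.mul hind).aemeasurable))

end GaussDecay

/-! ### Even moments and their Gaussian bounds. -/

/-- The even moment `E X ^ (2 * k)` of a centred Gaussian variable of variance `1 / lam`. -/
noncomputable def gaussMoment (lam : ℝ) (k : ℕ) : ℝ :=
  (Nat.factorial (2 * k) : ℝ) / (Nat.factorial k * (2 * lam) ^ k)

theorem gaussMoment_nonneg {lam : ℝ} (hlam : 0 < lam) (k : ℕ) : 0 ≤ gaussMoment lam k := by
  unfold gaussMoment
  positivity

theorem gaussMoment_succ {lam : ℝ} (hlam : 0 < lam) (k : ℕ) :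
    gaussMoment lam (k + 1) = lam⁻¹ * ((2 * k + 1) * gaussMoment lam k) := by
  unfold gaussMoment
  have h1 : Nat.factorial (2 * (k + 1)) = (2 * k + 2) * ((2 * k + 1) * Nat.factorial (2 * k)) := by
    rw [show 2 * (k + 1) = (2 * k + 1) + 1 by ring, Nat.factorial_succ, Nat.factorial_succ]
  rw [h1, Nat.factorial_succ]
  push_cast
  have := hlam.ne'
  have h2 : (Nat.factorial k : ℝ) ≠ 0 := by positivity
  field_simp
  ring

theorem setLIntegral_uIoc_pow (k : ℕ) (x : ℝ) :
    ∫⁻ s in Set.uIoc 0 x, ENNReal.ofReal ((2 * k + 1) * s ^ (2 * k)) =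
      ENNReal.ofReal (|x| ^ (2 * k + 1)) := by
  have hpos : ∀ s : ℝ, 0 ≤ (2 * k + 1 : ℝ) * s ^ (2 * k) := fun s => by
    have := (even_two_mul k).pow_nonneg s
    positivity
  have hint : IntegrableOn (fun s : ℝ => (2 * k + 1 : ℝ) * s ^ (2 * k)) (Set.uIoc 0 x) :=
    (Continuous.intervalIntegrable (by fun_prop) 0 x).def'
  rw [← ofReal_integral_eq_lintegral_ofReal hint (Eventually.of_forall hpos)]
  congr 1
  rw [← abs_of_nonneg (integral_nonneg hpos), ← intervalIntegral.abs_integral_eq_abs_integral_uIoc,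
    intervalIntegral.integral_const_mul, integral_pow, ← abs_pow]
  congr 1
  push_cast
  have : (2 * k + 1 : ℝ) ≠ 0 := by positivity
  field_simp
  simp

/-- The even part of the binomial expansion. -/
theorem sub_pow_add_add_pow (m : ℕ) (s t : ℝ) :
    (s - t) ^ (2 * m) + (s + t) ^ (2 * m) =
      2 * ∑ i ∈ range (m + 1), ((2 * m).choose (2 * i) : ℝ) * s ^ (2 * i) * t ^ (2 * (m - i)) := by
  have hsplit : ∀ (b : ℕ → ℝ) (m : ℕ), ∑ k ∈ range (2 * m + 1), b k =
      ∑ i ∈ range (m + 1), b (2 * i) + ∑ i ∈ range m, b (2 * i + 1) := by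
    intro b m
    induction m with
    | zero => simp
    | succ m ih =>
      rw [show 2 * (m + 1) + 1 = (2 * m + 1) + 1 + 1 by ring, sum_range_succ, sum_range_succ, ih,
        sum_range_succ (fun i => b (2 * i)) (m + 1), sum_range_succ (fun i => b (2 * i + 1)) m,
        show 2 * (m + 1) = 2 * m + 1 + 1 by ring]
      ring
  rw [sub_eq_add_neg, add_pow, add_pow, ← sum_add_distrib, hsplit, mul_sum]
  have hodd : ∑ i ∈ range m, (s ^ (2 * i + 1) * (-t) ^ (2 * m - (2 * i + 1)) *
      ((2 * m).choose (2 * i + 1) : ℝ) + s ^ (2 * i + 1) * t ^ (2 * m - (2 * i + 1)) *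
      ((2 * m).choose (2 * i + 1) : ℝ)) = 0 := by
    refine sum_eq_zero fun i hi => ?_
    rw [mem_range] at hi
    have : Odd (2 * m - (2 * i + 1)) := ⟨m - i - 1, by omega⟩
    rw [this.neg_pow]
    ring
  rw [hodd, add_zero]
  refine sum_congr rfl fun i _ => ?_
  rw [← Nat.mul_sub, (even_two_mul (m - i)).neg_pow]
  ring

/-- Both sides are the moment of order `2m` of the sum of two independent Gaussians of variance
`1/lam`. Algebraically, the factorials collapse to `m.choose i`, whose sum is `2 ^ m`. -/
theorem sum_choose_mul_gaussMoment {lam : ℝ} (hlam : 0 < lam) (m : ℕ) :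
    ∑ i ∈ range (m + 1), ((2 * m).choose (2 * i) : ℝ) * gaussMoment lam i *
      gaussMoment lam (m - i) = (Nat.factorial (2 * m) : ℝ) / Nat.factorial m / lam ^ m := by
  have h : ∀ i ∈ range (m + 1), ((2 * m).choose (2 * i) : ℝ) * gaussMoment lam i *
      gaussMoment lam (m - i) = (Nat.factorial (2 * m) : ℝ) / Nat.factorial m / (2 * lam) ^ m *
        (m.choose i : ℝ) := by
    intro i hi
    have hi : i ≤ m := Nat.lt_succ_iff.1 (mem_range.1 hi)
    unfold gaussMoment
    rw [Nat.cast_choose ℝ (by omega : 2 * i ≤ 2 * m), Nat.cast_choose ℝ hi, ← Nat.mul_sub]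
    have h1 : (2 * lam) ^ m = (2 * lam) ^ i * (2 * lam) ^ (m - i) := by
      rw [← pow_add, Nat.add_sub_cancel' hi]
    rw [h1]
    have := hlam.ne'
    have h2 : (Nat.factorial m : ℝ) ≠ 0 := by positivity
    have h3 : (Nat.factorial i : ℝ) ≠ 0 := by positivity
    have h4 : (Nat.factorial (m - i) : ℝ) ≠ 0 := by positivity
    have h5 : (Nat.factorial (2 * i) : ℝ) ≠ 0 := by positivity
    have h6 : (Nat.factorial (2 * (m - i)) : ℝ) ≠ 0 := by positivity
    field_simp
  rw [sum_congr rfl h, ← mul_sum, ← Nat.cast_sum, Nat.sum_range_choose, mul_pow]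
  push_cast
  have := hlam.ne'
  field_simp

namespace GaussDecay

variable {lam : ℝ} {p q : ℝ → ℝ}

theorem lintegral_eq_one (hp : GaussDecay lam p) : ∫⁻ x, ENNReal.ofReal (p x) = 1 := by
  rw [← ofReal_integral_eq_lintegral_ofReal hp.integrable (Eventually.of_forall hp.nonneg),
    hp.integral_eq_one, ENNReal.ofReal_one]

/-- Writing `x^(2k+2)` as `|x|` times the integral of `(2k+1) s^(2k)` between `0` and `x`, the Hardy
inequality gives the recursion that Gaussian moments satisfy with equality. -/
theorem lintegral_pow_le (hp : GaussDecay lam p) (hlam : 0 < lam) (k : ℕ) :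
    ∫⁻ x, ENNReal.ofReal (p x) * ENNReal.ofReal (x ^ (2 * k)) ≤
      ENNReal.ofReal (gaussMoment lam k) := by
  induction k with
  | zero => simp [hp.lintegral_eq_one, gaussMoment]
  | succ k ih =>
    have h1 : ∀ x : ℝ, ENNReal.ofReal (x ^ (2 * (k + 1))) =
        ENNReal.ofReal |x| * ∫⁻ s in Set.uIoc 0 x, ENNReal.ofReal ((2 * k + 1) * s ^ (2 * k)) := by
      intro x
      rw [setLIntegral_uIoc_pow, ← ENNReal.ofReal_mul (abs_nonneg x)]
      congr 1
      rw [← pow_succ', show 2 * k + 1 + 1 = 2 * (k + 1) by ring, (even_two_mul _).pow_abs]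
    simp_rw [h1]
    refine (hp.lintegral_mul_abs_mul_setLIntegral_le hlam (by fun_prop)).trans ?_
    rw [gaussMoment_succ hlam, ENNReal.ofReal_mul (by positivity),
      ENNReal.ofReal_mul (by positivity)]
    gcongr
    refine le_trans (le_of_eq ?_) (mul_le_mul_right ih _)
    rw [← lintegral_const_mul' _ _ ENNReal.ofReal_ne_top]
    congr 1
    ext x
    rw [ENNReal.ofReal_mul (by positivity)]
    ring

theorem integrable_mul_pow (hp : GaussDecay lam p) (hlam : 0 < lam) (k : ℕ) :
    Integrable (fun x => p x * x ^ (2 * k)) volume := by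
  refine ⟨hp.integrable.aestronglyMeasurable.mul (by fun_prop), ?_⟩
  rw [hasFiniteIntegral_iff_ofReal (Eventually.of_forall fun x =>
    mul_nonneg (hp.nonneg x) ((even_two_mul k).pow_nonneg x))]
  simp_rw [ENNReal.ofReal_mul (hp.nonneg _)]
  exact (hp.lintegral_pow_le hlam k).trans_lt ENNReal.ofReal_lt_top

theorem lintegral_mul_ofReal (hp : GaussDecay lam p) {f : ℝ → ℝ} (hf : ∀ x, 0 ≤ f x)
    (hi : Integrable (fun x => p x * f x) volume) :
    ∫⁻ x, ENNReal.ofReal (p x) * ENNReal.ofReal (f x) = ENNReal.ofReal (∫ x, p x * f x) := by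
  rw [ofReal_integral_eq_lintegral_ofReal hi
    (Eventually.of_forall fun x => mul_nonneg (hp.nonneg x) (hf x))]
  simp_rw [ENNReal.ofReal_mul (hp.nonneg _)]

theorem integral_mul_pow_le (hp : GaussDecay lam p) (hlam : 0 < lam) (k : ℕ) :
    ∫ x, p x * x ^ (2 * k) ≤ gaussMoment lam k := by
  have h := hp.lintegral_pow_le hlam k
  rw [hp.lintegral_mul_ofReal (fun x => (even_two_mul k).pow_nonneg x)
    (hp.integrable_mul_pow hlam k)] at h
  exact (ENNReal.ofReal_le_ofReal_iff (gaussMoment_nonneg hlam k)).1 h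

theorem integrable_mul_of_growth (hp : GaussDecay lam p) (hlam : 0 < lam) {f : ℝ → ℝ}
    (hf : Measurable f) {K : ℝ} {n : ℕ} (hK : ∀ x, |f x| ≤ K * (1 + x ^ (2 * n))) :
    Integrable (fun x => p x * f x) volume := by
  refine ((hp.integrable.add (hp.integrable_mul_pow hlam n)).const_mul K).mono'
    (hp.integrable.aestronglyMeasurable.mul hf.aestronglyMeasurable)
    (Eventually.of_forall fun x => ?_)
  rw [Real.norm_eq_abs, abs_mul, abs_of_nonneg (hp.nonneg x)]
  calc p x * |f x| ≤ p x * (K * (1 + x ^ (2 * n))) := by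
        gcongr
        · exact hp.nonneg x
        · exact hK x
    _ = K * (p x + p x * x ^ (2 * n)) := by ring

end GaussDecay

theorem sub_pow_two_mul_le (n : ℕ) (x t : ℝ) :
    (x - t) ^ (2 * n) ≤ 2 ^ (2 * n) * (x ^ (2 * n) + t ^ (2 * n)) := by
  have h0 := (even_two_mul n).pow_nonneg (x + t)
  have hx := (even_two_mul n).pow_nonneg x
  have ht := (even_two_mul n).pow_nonneg t
  have h1 : (|x| + |t|) ^ (2 * n) ≤ 2 ^ (2 * n - 1) * (|x| ^ (2 * n) + |t| ^ (2 * n)) :=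
    add_pow_le (abs_nonneg x) (abs_nonneg t) _
  rw [(even_two_mul n).pow_abs, (even_two_mul n).pow_abs] at h1
  calc (x - t) ^ (2 * n) = |x - t| ^ (2 * n) := ((even_two_mul n).pow_abs _).symm
    _ ≤ (|x| + |t|) ^ (2 * n) := by
        gcongr
        exact abs_sub x t
    _ ≤ _ := h1
    _ ≤ _ := by
        gcongr
        · norm_num
        · omega

namespace GaussDecay

variable {lam : ℝ} {p q : ℝ → ℝ}

theorem integrable_mul_sub_pow (hp : GaussDecay lam p) (hlam : 0 < lam) (m : ℕ) (t : ℝ) :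
    Integrable (fun s => p s * (s - t) ^ (2 * m)) volume := by
  have ht := (even_two_mul m).pow_nonneg t
  refine hp.integrable_mul_of_growth hlam (n := m) (K := 2 ^ (2 * m) * (1 + t ^ (2 * m)))
    (by fun_prop) fun s => ?_
  have hs := (even_two_mul m).pow_nonneg s
  rw [abs_of_nonneg ((even_two_mul m).pow_nonneg _), mul_assoc]
  refine (sub_pow_two_mul_le m s t).trans ?_
  gcongr
  nlinarith

theorem integral_comp_neg_mul (hp : GaussDecay lam p) (f : ℝ → ℝ) :
    ∫ s, p s * f (-s) = ∫ s, p s * f s := by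
  rw [← integral_neg_eq_self]
  simp only [neg_neg, hp.even _]

/-- Symmetry of `p` removes the odd powers of the binomial expansion. The remaining coefficients are
non-negative, so the moment bounds may be inserted term by term. -/
theorem integral_mul_sub_pow_le (hp : GaussDecay lam p) (hlam : 0 < lam) (m : ℕ) (t : ℝ) :
    ∫ s, p s * (s - t) ^ (2 * m) ≤ ∑ i ∈ range (m + 1),
      ((2 * m).choose (2 * i) : ℝ) * gaussMoment lam i * t ^ (2 * (m - i)) := by
  have h1 : ∫ s, p s * (s + t) ^ (2 * m) = ∫ s, p s * (s - t) ^ (2 * m) := by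
    rw [← hp.integral_comp_neg_mul]
    congr 1
    ext s
    rw [← (even_two_mul m).neg_pow (-s + t)]
    ring_nf
  have h2 : Integrable (fun s => p s * (s + t) ^ (2 * m)) volume := by
    simpa using hp.integrable_mul_sub_pow hlam m (-t)
  have h3 : 2 * ∫ s, p s * (s - t) ^ (2 * m) = 2 * ∑ i ∈ range (m + 1),
      ((2 * m).choose (2 * i) : ℝ) * t ^ (2 * (m - i)) * ∫ s, p s * s ^ (2 * i) := by
    rw [two_mul]
    nth_rewrite 2 [← h1]
    rw [← integral_add (hp.integrable_mul_sub_pow hlam m t) h2]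
    simp_rw [← mul_add, sub_pow_add_add_pow, ← integral_const_mul]
    rw [← integral_finsetSum _ fun i _ => (hp.integrable_mul_pow hlam i).const_mul _,
      ← integral_const_mul]
    congr 1
    ext s
    simp only [mul_sum]
    refine sum_congr rfl fun i _ => ?_
    ring
  have h4 := mul_left_cancel₀ two_ne_zero h3
  rw [h4]
  refine sum_le_sum fun i _ => ?_
  have ht := (even_two_mul (m - i)).pow_nonneg t
  calc _ ≤ ((2 * m).choose (2 * i) : ℝ) * t ^ (2 * (m - i)) * gaussMoment lam i := by
        gcongr
        exact hp.integral_mul_pow_le hlam i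
    _ = _ := by ring

/-- Even moments of the difference of two independent variables. -/
theorem lintegral_lintegral_sub_pow_le (hp : GaussDecay lam p) (hq : GaussDecay lam q)
    (hlam : 0 < lam) (m : ℕ) :
    ∫⁻ t, ENNReal.ofReal (q t) * ∫⁻ s, ENNReal.ofReal (p s) * ENNReal.ofReal ((s - t) ^ (2 * m)) ≤
      ENNReal.ofReal ((Nat.factorial (2 * m) : ℝ) / Nat.factorial m / lam ^ m) := by
  have hc : ∀ i, 0 ≤ ((2 * m).choose (2 * i) : ℝ) * gaussMoment lam i := fun i =>
    mul_nonneg (Nat.cast_nonneg _) (gaussMoment_nonneg hlam i)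
  have hint : Integrable (fun t => q t * ∑ i ∈ range (m + 1),
      ((2 * m).choose (2 * i) : ℝ) * gaussMoment lam i * t ^ (2 * (m - i))) volume := by
    simp_rw [mul_sum]
    refine integrable_finsetSum _ fun i _ => ?_
    refine ((hq.integrable_mul_pow hlam (m - i)).const_mul
      (((2 * m).choose (2 * i) : ℝ) * gaussMoment lam i)).congr (Eventually.of_forall fun t => ?_)
    simp only
    ring
  calc _ ≤ ∫⁻ t, ENNReal.ofReal (q t) * ENNReal.ofReal (∑ i ∈ range (m + 1),
          ((2 * m).choose (2 * i) : ℝ) * gaussMoment lam i * t ^ (2 * (m - i))) := by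
        refine lintegral_mono fun t => ?_
        dsimp only
        rw [hp.lintegral_mul_ofReal (fun s => (even_two_mul m).pow_nonneg _)
          (hp.integrable_mul_sub_pow hlam m t)]
        gcongr
        exact hp.integral_mul_sub_pow_le hlam m t
    _ ≤ _ := by
        rw [hq.lintegral_mul_ofReal (fun t => sum_nonneg fun i _ =>
          mul_nonneg (hc i) ((even_two_mul (m - i)).pow_nonneg t)) hint]
        apply ENNReal.ofReal_le_ofReal
        rw [← sum_choose_mul_gaussMoment hlam]
        simp_rw [mul_sum]
        have hcomm : ∀ t i, q t * (((2 * m).choose (2 * i) : ℝ) * gaussMoment lam i *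
            t ^ (2 * (m - i))) = ((2 * m).choose (2 * i) : ℝ) * gaussMoment lam i *
            (q t * t ^ (2 * (m - i))) := fun t i => by ring
        simp_rw [hcomm]
        rw [integral_finsetSum _ fun i _ => (hq.integrable_mul_pow hlam (m - i)).const_mul _]
        refine sum_le_sum fun i _ => ?_
        rw [integral_const_mul]
        exact mul_le_mul_of_nonneg_left (hq.integral_mul_pow_le hlam _) (hc i)

end GaussDecay

/-! ### Confining potentials and their Gibbs densities. -/

/-- Even interaction potentials of polynomial growth whose symmetrised translates are uniformly
convex in the weak sense that suffices for Gaussian decay of the Gibbs densities. -/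
structure Confining (lam B K : ℝ) (n : ℕ) (φ : ℝ → ℝ) : Prop where
  continuous : Continuous φ
  even : Function.Even φ
  lower : ∀ y, -B ≤ φ y
  growth : ∀ y, |φ y| ≤ K * (1 + y ^ (2 * n))
  mono : ∀ t u x, 0 ≤ u → u ≤ x →
    φ (u - t) + φ (u + t) + lam * (x ^ 2 - u ^ 2) ≤ φ (x - t) + φ (x + t)

/-- The Gibbs density of the potential `φ ⋆ μ`. -/
noncomputable def gibbs (φ μ : ℝ → ℝ) (y : ℝ) : ℝ :=
  (∫ z, Real.exp (-conv φ μ z))⁻¹ * Real.exp (-conv φ μ y)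

theorem conv_apply (φ μ : ℝ → ℝ) (y : ℝ) : conv φ μ y = ∫ t, μ t * φ (y - t) := rfl

theorem conv_even {φ μ : ℝ → ℝ} (hφ : Function.Even φ) (hμ : Function.Even μ) :
    Function.Even (conv φ μ) := by
  intro y
  rw [conv_apply, conv_apply, ← integral_neg_eq_self]
  congr 1
  ext t
  rw [hμ, ← hφ]
  ring_nf

theorem integral_mul_comp_add {φ μ : ℝ → ℝ} (hμ : Function.Even μ) (y : ℝ) :
    ∫ t, μ t * φ (y + t) = conv φ μ y := by
  rw [conv_apply, ← integral_neg_eq_self]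
  simp only [hμ _, sub_eq_add_neg]

theorem integrable_mul_comp_add {φ μ : ℝ → ℝ} (hμ : Function.Even μ) {y : ℝ}
    (h : Integrable (fun t => μ t * φ (y - t)) volume) :
    Integrable (fun t => μ t * φ (y + t)) volume := by
  refine h.comp_neg.congr (Eventually.of_forall fun t => ?_)
  simp only [hμ _, sub_neg_eq_add]

theorem aestronglyMeasurable_conv {φ μ : ℝ → ℝ} (hφ : Continuous φ)
    (hμ : AEStronglyMeasurable μ volume) : AEStronglyMeasurable (conv φ μ) volume := by
  have h : AEStronglyMeasurable (fun z : ℝ × ℝ => μ z.2 * φ (z.1 - z.2))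
      (volume.prod volume) :=
    hμ.comp_snd.mul (by fun_prop)
  exact h.integral_prod_right'

/-- For even `μ`, `2 (φ ⋆ μ)(y)` is the integral of `φ(y - t) + φ(y + t)` against `μ`. An inequality
for symmetrised translates, which is weaker than one for `φ` itself, therefore passes to the
convolution. -/
theorem conv_add_le {φ μ : ℝ → ℝ} (h0 : ∀ y, 0 ≤ μ y) (hint : Integrable μ volume)
    (h1 : ∫ y, μ y = 1) (heven : Function.Even μ)
    (hex : ∀ y, Integrable (fun t => μ t * φ (y - t)) volume) {u x c : ℝ}
    (h : ∀ t, φ (u - t) + φ (u + t) + 2 * c ≤ φ (x - t) + φ (x + t)) :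
    conv φ μ u + c ≤ conv φ μ x := by
  have hsum : ∀ y, ∫ t, (μ t * φ (y - t) + μ t * φ (y + t)) = 2 * conv φ μ y := fun y => by
    rw [integral_add (hex y) (integrable_mul_comp_add heven (hex y)), integral_mul_comp_add heven,
      ← conv_apply, two_mul]
  have hi : ∀ y, Integrable (fun t => μ t * φ (y - t) + μ t * φ (y + t)) volume := fun y =>
    (hex y).add (integrable_mul_comp_add heven (hex y))
  have hle : ∫ t, ((μ t * φ (u - t) + μ t * φ (u + t)) + μ t * (2 * c)) ≤
      ∫ t, (μ t * φ (x - t) + μ t * φ (x + t)) := by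
    refine integral_mono ((hi u).add (hint.mul_const _)) (hi x) fun t => ?_
    have := mul_le_mul_of_nonneg_left (h t) (h0 t)
    simp only [mul_add] at this ⊢
    linarith
  rw [integral_add (hi u) (hint.mul_const _), hsum, hsum, integral_mul_const, h1] at hle
  linarith

/-- Integrability is a hypothesis here instead of a consequence of `GaussDecay`, so that the
estimate applies to an arbitrary invariant density before its decay is known. -/
theorem Confining.conv_increment {lam B K : ℝ} {n : ℕ} {φ μ : ℝ → ℝ}
    (hφ : Confining lam B K n φ) (h0 : ∀ y, 0 ≤ μ y) (hint : Integrable μ volume)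
    (h1 : ∫ y, μ y = 1) (heven : Function.Even μ)
    (hex : ∀ y, Integrable (fun t => μ t * φ (y - t)) volume) {u x : ℝ} (hu : 0 ≤ u)
    (hux : u ≤ x) : conv φ μ u + lam / 2 * (x ^ 2 - u ^ 2) ≤ conv φ μ x :=
  conv_add_le h0 hint h1 heven hex fun t => by linarith [hφ.mono t u x hu hux]

theorem gaussDecay_of_potential {lam : ℝ} {V p : ℝ → ℝ} (heven : Function.Even V)
    (hint : Integrable (fun y => Real.exp (-V y)) volume)
    (hV : ∀ u x, 0 ≤ u → u ≤ x → V u + lam / 2 * (x ^ 2 - u ^ 2) ≤ V x)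
    (hp : ∀ y, p y = (∫ z, Real.exp (-V z))⁻¹ * Real.exp (-V y)) : GaussDecay lam p := by
  have hZ : 0 < ∫ z, Real.exp (-V z) := integral_exp_pos hint
  have hp' : p = fun y => (∫ z, Real.exp (-V z))⁻¹ * Real.exp (-V y) := funext hp
  refine ⟨fun y => ?_, ?_, ?_, fun y => ?_, fun u x hu hux => ?_⟩
  · rw [hp]
    positivity
  · rw [hp']
    exact hint.const_mul _
  · rw [hp', integral_const_mul, inv_mul_cancel₀ hZ.ne']
  · rw [hp, hp, heven]
  · rw [hp, hp, mul_assoc, ← Real.exp_add]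
    gcongr
    linarith [hV u x hu hux]

/-- A priori decay: uniqueness can thus be proved among all invariant densities and not only among
those with Gaussian decay. -/
theorem IsInvariantDensity.gaussDecay {lam B K : ℝ} {n : ℕ} {φ π : ℝ → ℝ}
    (hφ : Confining lam B K n φ) (h : IsInvariantDensity φ π) : GaussDecay lam π :=
  gaussDecay_of_potential (conv_even hφ.even h.even) h.exp_integrable
    (fun _ _ hu hux => hφ.conv_increment h.nonneg h.integrable h.integral_eq_one h.even
      h.conv_exists hu hux) h.self_consistent

theorem IsInvariantDensity.eq_gibbs {φ π : ℝ → ℝ} (h : IsInvariantDensity φ π) :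
    π = gibbs φ π := funext h.self_consistent

theorem IsInvariantDensity.pos {φ π : ℝ → ℝ} (h : IsInvariantDensity φ π) (y : ℝ) :
    0 < π y := by
  rw [h.self_consistent]
  have := integral_exp_pos h.exp_integrable
  positivity

namespace Confining

variable {lam B K : ℝ} {n : ℕ} {φ μ : ℝ → ℝ}

theorem K_nonneg (hφ : Confining lam B K n φ) : 0 ≤ K := by
  have h := (abs_nonneg _).trans (hφ.growth 0)
  rcases Nat.eq_zero_or_pos n with rfl | hn
  · norm_num at h
    linarith
  · simpa [zero_pow (by omega : 2 * n ≠ 0)] using h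

theorem growth_sub (hφ : Confining lam B K n φ) (y t : ℝ) :
    |φ (y - t)| ≤ K * (2 ^ (2 * n) * (1 + y ^ (2 * n))) * (1 + t ^ (2 * n)) := by
  have hy := (even_two_mul n).pow_nonneg y
  have ht := (even_two_mul n).pow_nonneg t
  have hK := hφ.K_nonneg
  have h2 : (1 : ℝ) ≤ 2 ^ (2 * n) := one_le_pow₀ (by norm_num)
  refine (hφ.growth _).trans ?_
  rw [mul_assoc]
  gcongr
  have := sub_pow_two_mul_le n y t
  nlinarith [mul_nonneg (mul_nonneg (by positivity : (0 : ℝ) ≤ 2 ^ (2 * n)) hy) ht]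

theorem integrable_conv (hφ : Confining lam B K n φ) (hlam : 0 < lam) (hμ : GaussDecay lam μ)
    (y : ℝ) : Integrable (fun t => μ t * φ (y - t)) volume :=
  hμ.integrable_mul_of_growth hlam
    (hφ.continuous.comp (continuous_const.sub continuous_id)).measurable (hφ.growth_sub y)

theorem conv_increment' (hφ : Confining lam B K n φ) (hlam : 0 < lam) (hμ : GaussDecay lam μ)
    {u x : ℝ} (hu : 0 ≤ u) (hux : u ≤ x) :
    conv φ μ u + lam / 2 * (x ^ 2 - u ^ 2) ≤ conv φ μ x :=
  hφ.conv_increment hμ.nonneg hμ.integrable hμ.integral_eq_one hμ.even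
    (hφ.integrable_conv hlam hμ) hu hux

/-- The lower bound does not depend on `μ`, which supplies one Gaussian dominating function for the
whole Picard iteration. -/
theorem le_conv (hφ : Confining lam B K n φ) (hlam : 0 < lam) (hμ : GaussDecay lam μ) (x : ℝ) :
    -B + lam / 2 * x ^ 2 ≤ conv φ μ x := by
  have h0 : -B ≤ conv φ μ 0 := by
    have : ∫ t, μ t * (-B) ≤ ∫ t, μ t * φ (0 - t) :=
      integral_mono (hμ.integrable.mul_const _) (hφ.integrable_conv hlam hμ 0) fun t =>
        mul_le_mul_of_nonneg_left (hφ.lower _) (hμ.nonneg t)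
    rwa [integral_mul_const, hμ.integral_eq_one, one_mul] at this
  have h1 := hφ.conv_increment' hlam hμ le_rfl (abs_nonneg x)
  have h2 : conv φ μ |x| = conv φ μ x := by
    rcases abs_choice x with h | h <;> rw [h]
    exact conv_even hφ.even hμ.even x
  rw [h2, sq_abs] at h1
  linarith

theorem exp_conv_le (hφ : Confining lam B K n φ) (hlam : 0 < lam) (hμ : GaussDecay lam μ)
    (x : ℝ) : Real.exp (-conv φ μ x) ≤ Real.exp B * Real.exp (-(lam / 2) * x ^ 2) := by
  rw [← Real.exp_add]
  gcongr
  linarith [hφ.le_conv hlam hμ x]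

theorem exp_integrable (hφ : Confining lam B K n φ) (hlam : 0 < lam) (hμ : GaussDecay lam μ) :
    Integrable (fun y => Real.exp (-conv φ μ y)) volume := by
  refine ((integrable_exp_neg_mul_sq (half_pos hlam)).const_mul (Real.exp B)).mono'
    (Real.continuous_exp.comp_aestronglyMeasurable
      (aestronglyMeasurable_conv hφ.continuous hμ.integrable.aestronglyMeasurable).neg)
    (Eventually.of_forall fun x => ?_)
  rw [Real.norm_eq_abs, Real.abs_exp]
  exact hφ.exp_conv_le hlam hμ x

theorem gaussDecay_gibbs (hφ : Confining lam B K n φ) (hlam : 0 < lam) (hμ : GaussDecay lam μ) :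
    GaussDecay lam (gibbs φ μ) :=
  gaussDecay_of_potential (conv_even hφ.even hμ.even) (hφ.exp_integrable hlam hμ)
    (fun _ _ hu hux => hφ.conv_increment' hlam hμ hu hux) fun _ => rfl

theorem gibbs_pos (hφ : Confining lam B K n φ) (hlam : 0 < lam) (hμ : GaussDecay lam μ) (y : ℝ) :
    0 < gibbs φ μ y := by
  have := integral_exp_pos (hφ.exp_integrable hlam hμ)
  unfold gibbs
  positivity

theorem isInvariantDensity_of_eq_gibbs (hφ : Confining lam B K n φ) (hlam : 0 < lam)
    (hμ : GaussDecay lam μ) (h : μ = gibbs φ μ) : IsInvariantDensity φ μ where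
  nonneg := hμ.nonneg
  integrable := hμ.integrable
  integral_eq_one := hμ.integral_eq_one
  even := hμ.even
  conv_exists := hφ.integrable_conv hlam hμ
  exp_integrable := hφ.exp_integrable hlam hμ
  self_consistent := fun y => congrFun h y

end Confining

/-! ### Cauchy-Schwarz and the Hellinger distance. -/

theorem sq_integral_abs_mul_le {α : Type*} [MeasurableSpace α] {ν : Measure α} {u v : α → ℝ}
    (hu : AEStronglyMeasurable u ν) (hv : AEStronglyMeasurable v ν)
    (hu2 : Integrable (fun x => u x ^ 2) ν) (hv2 : Integrable (fun x => v x ^ 2) ν) :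
    Integrable (fun x => u x * v x) ν ∧
      (∫ x, |u x * v x| ∂ν) ^ 2 ≤ (∫ x, u x ^ 2 ∂ν) * ∫ x, v x ^ 2 ∂ν := by
  have huv : Integrable (fun x => u x * v x) ν := by
    refine (hu2.add hv2).mono' (hu.mul hv) (Eventually.of_forall fun x => ?_)
    rw [Real.norm_eq_abs, Pi.add_apply, abs_le]
    constructor <;> nlinarith [sq_nonneg (u x + v x), sq_nonneg (u x - v x)]
  refine ⟨huv, ?_⟩
  have h : ∀ y : ℝ, 0 ≤ (∫ x, u x ^ 2 ∂ν) * (y * y) + (2 * ∫ x, |u x * v x| ∂ν) * y +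
      ∫ x, v x ^ 2 ∂ν := by
    intro y
    have h1 : 0 ≤ ∫ x, (u x ^ 2 * (y * y) + |u x * v x| * (2 * y) + v x ^ 2) ∂ν := by
      refine integral_nonneg fun x => ?_
      have : u x ^ 2 * (y * y) + |u x * v x| * (2 * y) + v x ^ 2 = (|u x| * y + |v x|) ^ 2 := by
        rw [abs_mul, ← sq_abs (u x), ← sq_abs (v x)]
        ring
      simp only [Pi.zero_apply]
      rw [this]
      positivity
    have hi : Integrable (fun x => u x ^ 2 * (y * y) + |u x * v x| * (2 * y)) ν :=
      (hu2.mul_const _).add (huv.abs.mul_const _)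
    rw [integral_add hi hv2,
      integral_add (hu2.mul_const _) (huv.abs.mul_const _), integral_mul_const,
      integral_mul_const] at h1
    linarith
  have := discrim_le_zero h
  unfold discrim at this
  linarith

/-- The squared Hellinger distance. -/
noncomputable def hell (p q : ℝ → ℝ) : ℝ := ∫ x, (√(p x) - √(q x)) ^ 2

theorem hell_nonneg (p q : ℝ → ℝ) : 0 ≤ hell p q := integral_nonneg fun _ => sq_nonneg _

theorem hell_comm (p q : ℝ → ℝ) : hell p q = hell q p := by
  unfold hell
  congr 1
  ext x
  ring

theorem aestronglyMeasurable_sqrt {p : ℝ → ℝ} (hp : AEStronglyMeasurable p volume) :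
    AEStronglyMeasurable (fun x => √(p x)) volume :=
  Real.continuous_sqrt.comp_aestronglyMeasurable hp

theorem integrable_hell {p q : ℝ → ℝ} (hp0 : ∀ x, 0 ≤ p x) (hq0 : ∀ x, 0 ≤ q x)
    (hp : Integrable p volume) (hq : Integrable q volume) :
    Integrable (fun x => (√(p x) - √(q x)) ^ 2) volume := by
  refine (hp.add hq).mono' (((aestronglyMeasurable_sqrt hp.1).sub
    (aestronglyMeasurable_sqrt hq.1)).pow 2) (Eventually.of_forall fun x => ?_)
  rw [Real.norm_eq_abs, abs_of_nonneg (sq_nonneg _), Pi.add_apply]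
  have h1 := Real.sqrt_nonneg (p x)
  have h2 := Real.sqrt_nonneg (q x)
  nlinarith [Real.sq_sqrt (hp0 x), Real.sq_sqrt (hq0 x), mul_nonneg h1 h2]

/-- Cauchy-Schwarz applied to `q - p = (√q - √p)(√q + √p)`, with `(√q + √p)² ≤ 2p + 2q`. -/
theorem sq_integral_abs_sub_mul_le {p q f : ℝ → ℝ} (hp0 : ∀ x, 0 ≤ p x) (hq0 : ∀ x, 0 ≤ q x)
    (hp : Integrable p volume) (hq : Integrable q volume) (hf : AEStronglyMeasurable f volume)
    (hpf : Integrable (fun x => p x * f x ^ 2) volume)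
    (hqf : Integrable (fun x => q x * f x ^ 2) volume) :
    Integrable (fun x => (q x - p x) * f x) volume ∧
      (∫ x, |(q x - p x) * f x|) ^ 2 ≤
        hell p q * (2 * (∫ x, p x * f x ^ 2) + 2 * ∫ x, q x * f x ^ 2) := by
  have hsp := aestronglyMeasurable_sqrt hp.1
  have hsq := aestronglyMeasurable_sqrt hq.1
  have hle : ∀ x, ((√(q x) + √(p x)) * f x) ^ 2 ≤ 2 * (p x * f x ^ 2) + 2 * (q x * f x ^ 2) := by
    intro x
    nlinarith [Real.sq_sqrt (hp0 x), Real.sq_sqrt (hq0 x),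
      sq_nonneg ((√(q x) - √(p x)) * f x), sq_nonneg (f x)]
  have hv2 : Integrable (fun x => ((√(q x) + √(p x)) * f x) ^ 2) volume := by
    refine ((hpf.const_mul 2).add (hqf.const_mul 2)).mono' (((hsq.add hsp).mul hf).pow 2)
      (Eventually.of_forall fun x => ?_)
    rw [Real.norm_eq_abs, abs_of_nonneg (sq_nonneg _)]
    exact hle x
  obtain ⟨h1, h2⟩ := sq_integral_abs_mul_le (hsq.sub hsp) ((hsq.add hsp).mul hf)
    (integrable_hell hq0 hp0 hq hp) hv2
  have heq : ∀ x, (√(q x) - √(p x)) * ((√(q x) + √(p x)) * f x) = (q x - p x) * f x := by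
    intro x
    linear_combination (f x) * (Real.sq_sqrt (hq0 x) - Real.sq_sqrt (hp0 x))
  simp only [Pi.sub_apply, Pi.add_apply, Pi.mul_apply] at h1 h2
  simp only [heq] at h1 h2
  refine ⟨h1, h2.trans ?_⟩
  rw [hell_comm]
  refine mul_le_mul_of_nonneg_left ?_ (hell_nonneg q p)
  rw [← integral_const_mul, ← integral_const_mul, ← integral_add (hpf.const_mul 2)
    (hqf.const_mul 2)]
  exact integral_mono hv2 ((hpf.const_mul 2).add (hqf.const_mul 2)) hle

/-- With `r = √a / √b ≥ 1` this is the inequality `log r ≥ 2(r - 1)/(r + 1)`. -/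
theorem four_mul_sq_sqrt_sub_le {a b : ℝ} (ha : 0 < a) (hb : 0 < b) :
    4 * (√a - √b) ^ 2 ≤ (a - b) * (Real.log a - Real.log b) := by
  wlog hab : b ≤ a generalizing a b
  · have := this hb ha (le_of_not_ge hab)
    nlinarith
  have hx := Real.sqrt_pos.2 ha
  have hy := Real.sqrt_pos.2 hb
  have hxy := Real.sqrt_le_sqrt hab
  have hla : Real.log a = 2 * Real.log √a := by
    rw [Real.log_sqrt ha.le]
    ring
  have hlb : Real.log b = 2 * Real.log √b := by
    rw [Real.log_sqrt hb.le]
    ring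
  have h1 := Real.le_log_one_add_of_nonneg (x := √a / √b - 1) (by
    rw [sub_nonneg, le_div_iff₀ hy]
    linarith)
  rw [add_sub_cancel, Real.log_div hx.ne' hy.ne'] at h1
  have h2 : 2 * (√a / √b - 1) / (√a / √b - 1 + 2) = 2 * (√a - √b) / (√a + √b) := by
    rw [show √a / √b - 1 + 2 = (√a + √b) / √b by field_simp; ring,
      show √a / √b - 1 = (√a - √b) / √b by field_simp]
    field_simp
  rw [h2, div_le_iff₀ (by positivity)] at h1
  rw [hla, hlb]
  calc 4 * (√a - √b) ^ 2 = 2 * (√a - √b) * (2 * (√a - √b)) := by ring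
    _ ≤ 2 * (√a - √b) * ((Real.log √a - Real.log √b) * (√a + √b)) := by
        refine mul_le_mul_of_nonneg_left h1 ?_
        linarith
    _ = (√a ^ 2 - √b ^ 2) * (2 * Real.log √a - 2 * Real.log √b) := by ring
    _ = _ := by rw [Real.sq_sqrt ha.le, Real.sq_sqrt hb.le]

/-- Integrating `4(√p - √q)² ≤ (p - q)(W + c)` kills `c` because the masses agree. Young's
inequality with weights `2` and `1/8` then absorbs half of the left side. -/
theorem hell_le_of_log_sub {p q W : ℝ → ℝ} {c : ℝ} (hp0 : ∀ x, 0 < p x) (hq0 : ∀ x, 0 < q x)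
    (hp : Integrable p volume) (hq : Integrable q volume) (hpq : ∫ x, p x = ∫ x, q x)
    (hW : ∀ x, Real.log (p x) - Real.log (q x) = W x + c)
    (hint : Integrable (fun x => (p x + q x) * W x ^ 2) volume) :
    hell p q ≤ 1 / 8 * ∫ x, (p x + q x) * W x ^ 2 := by
  have hle : ∀ x, 2 * (√(p x) - √(q x)) ^ 2 ≤
      1 / 4 * ((p x + q x) * W x ^ 2) + c * (p x - q x) := by
    intro x
    have h1 := four_mul_sq_sqrt_sub_le (hp0 x) (hq0 x)
    rw [hW] at h1
    have hsp := Real.sq_sqrt (hp0 x).le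
    have hsq := Real.sq_sqrt (hq0 x).le
    have h2 : (p x - q x) * W x ≤
        2 * (√(p x) - √(q x)) ^ 2 + 1 / 8 * ((√(p x) + √(q x)) * W x) ^ 2 := by
      have : (p x - q x) * W x = (√(p x) - √(q x)) * ((√(p x) + √(q x)) * W x) := by
        linear_combination (-W x) * (hsp - hsq)
      rw [this]
      nlinarith [sq_nonneg (4 * (√(p x) - √(q x)) - (√(p x) + √(q x)) * W x)]
    have h3 : ((√(p x) + √(q x)) * W x) ^ 2 ≤ 2 * ((p x + q x) * W x ^ 2) := by
      nlinarith [sq_nonneg ((√(q x) - √(p x)) * W x), sq_nonneg (W x)]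
    linarith
  have hi : Integrable (fun x => 1 / 4 * ((p x + q x) * W x ^ 2) + c * (p x - q x)) volume :=
    (hint.const_mul _).add ((hp.sub hq).const_mul c)
  have h := integral_mono ((integrable_hell (fun x => (hp0 x).le) (fun x => (hq0 x).le)
    hp hq).const_mul 2) hi hle
  have hd : Integrable (fun x => c * (p x - q x)) volume := (hp.sub hq).const_mul c
  rw [integral_add (hint.const_mul _) hd, integral_const_mul,
    integral_const_mul, integral_const_mul, integral_sub hp hq, hpq, sub_self, mul_zero] at h
  unfold hell
  linarith

/-- The integral of `min p q` is one minus half the `L¹` distance, and that distance is at most `2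
√(hell p q)` by Cauchy-Schwarz. -/
theorem one_sub_sqrt_hell_le_integral_min {p q : ℝ → ℝ} (hp0 : ∀ x, 0 ≤ p x)
    (hq0 : ∀ x, 0 ≤ q x) (hp : Integrable p volume) (hq : Integrable q volume)
    (hp1 : ∫ x, p x = 1) (hq1 : ∫ x, q x = 1) :
    1 - √(hell p q) ≤ ∫ x, min (p x) (q x) := by
  have h := (sq_integral_abs_sub_mul_le (f := fun _ => 1) hp0 hq0 hp hq
    aestronglyMeasurable_const (by simpa using hp) (by simpa using hq)).2
  simp only [mul_one, one_pow, hp1, hq1] at h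
  have h2 : ∫ x, |q x - p x| ≤ 2 * √(hell p q) := by
    refine abs_le_of_sq_le_sq' ?_ (by positivity) |>.2
    rw [mul_pow, Real.sq_sqrt (hell_nonneg p q)]
    linarith
  have h3 : ∀ x, min (p x) (q x) = 1 / 2 * (p x + q x - |q x - p x|) := by
    intro x
    rcases le_total (p x) (q x) with h | h
    · rw [min_eq_left h, abs_of_nonneg (sub_nonneg.2 h)]
      ring
    · rw [min_eq_right h, abs_of_nonpos (sub_nonpos.2 h)]
      ring
  simp_rw [h3]
  have hi : Integrable (fun x => |q x - p x|) volume := (hq.sub hp).abs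
  have hs : Integrable (fun x => p x + q x) volume := hp.add hq
  rw [integral_const_mul, integral_sub hs hi, integral_add hp hq, hp1, hq1]
  linarith

/-! ### The Gibbs map contracts the Hellinger distance. -/

/-- Potentials whose derivative is a linear term plus a part `g` of small energy
`E g(X - Y)² ≤ lam * κ` under all pairs of densities with Gaussian decay. -/
structure Contractive (lam κ a : ℝ) (φ g : ℝ → ℝ) : Prop where
  hasDerivAt : ∀ y, HasDerivAt φ (2 * a * y + g y) y
  continuous : Continuous g
  nonneg : 0 ≤ κ
  energy : ∀ μ p, GaussDecay lam μ → GaussDecay lam p →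
    ∫⁻ t, ENNReal.ofReal (μ t) * ∫⁻ s, ENNReal.ofReal (p s) * ENNReal.ofReal (g (s - t) ^ 2) ≤
      ENNReal.ofReal (lam * κ)

/-- The increment from `-t` to `x - t` of `φ` without its quadratic part. -/
def incr (a : ℝ) (φ : ℝ → ℝ) (x t : ℝ) : ℝ :=
  (φ (x - t) - a * (x - t) ^ 2) - (φ (-t) - a * t ^ 2)

theorem continuous_incr {a : ℝ} {φ : ℝ → ℝ} (hφ : Continuous φ) :
    Continuous (fun z : ℝ × ℝ => incr a φ z.1 z.2) := by
  unfold incr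
  fun_prop

/-- Removing the quadratic part makes `incr` the integral of `g(s - t)` over `s` from `0` to `x`;
Cauchy-Schwarz on that interval costs the factor `|x|`, which is the weight in the Hardy inequality.
-/
theorem Contractive.ofReal_incr_sq_le {lam κ a : ℝ} {φ g : ℝ → ℝ}
    (h : Contractive lam κ a φ g) (x t : ℝ) :
    ENNReal.ofReal (incr a φ x t ^ 2) ≤
      ENNReal.ofReal |x| * ∫⁻ s in Set.uIoc 0 x, ENNReal.ofReal (g (s - t) ^ 2) := by
  have hg : Continuous fun s => g (s - t) := h.continuous.comp (by fun_prop)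
  have hftc : ∫ s in (0 : ℝ)..x, g (s - t) = incr a φ x t := by
    have hder : ∀ s ∈ Set.uIcc 0 x,
        HasDerivAt (fun s => φ (s - t) - a * (s - t) ^ 2) (g (s - t)) s := by
      intro s _
      have h1 : HasDerivAt (fun s : ℝ => s - t) 1 s := (hasDerivAt_id s).sub_const t
      have h2 := ((h.hasDerivAt (s - t)).comp s h1).sub ((h1.pow 2).const_mul a)
      refine h2.congr_deriv ?_
      norm_num
      ring
    rw [intervalIntegral.integral_eq_sub_of_hasDerivAt hder (hg.intervalIntegrable _ _)]
    unfold incr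
    simp
  have hi : ∀ f : ℝ → ℝ, Continuous f → Integrable f (volume.restrict (Set.uIoc 0 x)) :=
    fun f hf => (hf.intervalIntegrable 0 x).def'
  obtain ⟨h1, h2⟩ := sq_integral_abs_mul_le (ν := volume.restrict (Set.uIoc 0 x))
    (u := fun _ => (1 : ℝ)) (v := fun s => g (s - t)) aestronglyMeasurable_const
    hg.aestronglyMeasurable (hi _ (by fun_prop)) (hi _ (hg.pow 2))
  have hg2 : Integrable (fun s => g (s - t) ^ 2) (volume.restrict (Set.uIoc 0 x)) :=
    hi _ (hg.pow 2)
  rw [← ofReal_integral_eq_lintegral_ofReal hg2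
    (Eventually.of_forall fun s => sq_nonneg _), ← ENNReal.ofReal_mul (abs_nonneg x)]
  apply ENNReal.ofReal_le_ofReal
  have h3 : |incr a φ x t| ≤ ∫ s in Set.uIoc 0 x, |1 * g (s - t)| := by
    rw [← hftc, intervalIntegral.abs_integral_eq_abs_integral_uIoc]
    simp only [one_mul]
    exact abs_integral_le_integral_abs
  have h4 : ∫ s in Set.uIoc 0 x, (1 : ℝ) ^ 2 = |x| := by
    simp [Set.uIoc, measureReal_def, max_sub_min_eq_abs]
  rw [h4] at h2
  refine le_trans ?_ h2
  rw [← sq_abs (incr a φ x t)]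
  exact pow_le_pow_left₀ (abs_nonneg _) h3 2

/-- Poincaré-type bound for increments under a product of densities with Gaussian decay. -/
theorem Contractive.lintegral_incr_sq_le {lam κ a : ℝ} {φ g μ p : ℝ → ℝ}
    (h : Contractive lam κ a φ g) (hφ : Continuous φ) (hlam : 0 < lam) (hμ : GaussDecay lam μ)
    (hp : GaussDecay lam p) :
    ∫⁻ x, ENNReal.ofReal (p x) * ∫⁻ t, ENNReal.ofReal (μ t) *
      ENNReal.ofReal (incr a φ x t ^ 2) ≤ ENNReal.ofReal κ := by
  have hD : Measurable fun z : ℝ × ℝ => ENNReal.ofReal (incr a φ z.1 z.2 ^ 2) :=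
    ((continuous_incr hφ).pow 2).measurable.ennreal_ofReal
  have hcm : ∀ (c : ℝ) (f : ℝ → ℝ≥0∞), ENNReal.ofReal c * ∫⁻ t, f t =
      ∫⁻ t, ENNReal.ofReal c * f t := fun c f =>
    (lintegral_const_mul' _ _ ENNReal.ofReal_ne_top).symm
  simp_rw [hcm]
  rw [lintegral_lintegral_swap]
  · have hinv : ENNReal.ofReal κ = ENNReal.ofReal lam⁻¹ * ENNReal.ofReal (lam * κ) := by
      rw [← ENNReal.ofReal_mul (by positivity), inv_mul_cancel_left₀ hlam.ne']
    rw [hinv]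
    -- For each fixed `t`, the Hardy inequality in `x` reduces the claim to the energy bound.
    refine le_trans ?_ (mul_le_mul_right (h.energy μ p hμ hp) _)
    rw [hcm]
    refine lintegral_mono fun t => ?_
    have hK := hp.lintegral_mul_abs_mul_setLIntegral_le hlam
      (F := fun s => ENNReal.ofReal (g (s - t) ^ 2))
      ((h.continuous.comp (by fun_prop)).pow 2).measurable.ennreal_ofReal
    calc ∫⁻ x, ENNReal.ofReal (p x) * (ENNReal.ofReal (μ t) * ENNReal.ofReal (incr a φ x t ^ 2))
        = ENNReal.ofReal (μ t) * ∫⁻ x, ENNReal.ofReal (p x) *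
            ENNReal.ofReal (incr a φ x t ^ 2) := by
          rw [hcm]
          congr 1
          ext x
          ring
      _ ≤ ENNReal.ofReal (μ t) * ∫⁻ x, ENNReal.ofReal (p x) * (ENNReal.ofReal |x| *
            ∫⁻ s in Set.uIoc 0 x, ENNReal.ofReal (g (s - t) ^ 2)) := by
          gcongr with x
          exact h.ofReal_incr_sq_le x t
      _ ≤ ENNReal.ofReal (μ t) * (ENNReal.ofReal lam⁻¹ * ∫⁻ s, ENNReal.ofReal (p s) *
            ENNReal.ofReal (g (s - t) ^ 2)) := by
          gcongr
      _ = _ := by ring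
  · exact (hp.aemeasurable_ofReal.comp_quasiMeasurePreserving
      Measure.quasiMeasurePreserving_fst).mul
      ((hμ.aemeasurable_ofReal.comp_quasiMeasurePreserving
      Measure.quasiMeasurePreserving_snd).mul hD.aemeasurable)

theorem GaussDecay.integral_mul_id {lam : ℝ} {p : ℝ → ℝ} (hp : GaussDecay lam p) :
    ∫ t, p t * t = 0 := by
  have h := hp.integral_comp_neg_mul fun t => t
  simp only [mul_neg, integral_neg] at h
  linarith

theorem GaussDecay.integrable_mul_id {lam : ℝ} {p : ℝ → ℝ} (hp : GaussDecay lam p)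
    (hlam : 0 < lam) : Integrable (fun t => p t * t) volume :=
  hp.integrable_mul_of_growth hlam (n := 1) (K := 1) measurable_id fun x => by
    rw [abs_le, one_mul, mul_one]
    constructor <;> nlinarith [sq_nonneg (x + 1), sq_nonneg (x - 1)]

namespace Confining

variable {lam B K κ a : ℝ} {n : ℕ} {φ g μ μ₀ μ₁ p : ℝ → ℝ}

/-- The quadratic part contributes `a x²` whatever `μ` is, since the cross term `-2 a x t`
integrates to zero. It cancels when two densities are compared. -/
theorem integral_mul_incr (hφ : Confining lam B K n φ) (hlam : 0 < lam) (hμ : GaussDecay lam μ)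
    (x : ℝ) : Integrable (fun t => μ t * incr a φ x t) volume ∧
      ∫ t, μ t * incr a φ x t = conv φ μ x - conv φ μ 0 - a * x ^ 2 := by
  have h1 := hφ.integrable_conv hlam hμ x
  have h2 := hφ.integrable_conv hlam hμ 0
  have h3 : Integrable (fun t => μ t * φ (x - t) - μ t * φ (0 - t)) volume := h1.sub h2
  have h4 : Integrable (fun t => μ t * (a * x ^ 2) - (μ t * t) * (2 * a * x)) volume :=
    (hμ.integrable.mul_const _).sub ((hμ.integrable_mul_id hlam).mul_const _)
  have heq : ∀ t, μ t * incr a φ x t = (μ t * φ (x - t) - μ t * φ (0 - t)) -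
      (μ t * (a * x ^ 2) - (μ t * t) * (2 * a * x)) := fun t => by
    unfold incr
    rw [zero_sub]
    ring
  simp_rw [heq]
  refine ⟨h3.sub h4, ?_⟩
  rw [integral_sub h3 h4, integral_sub h1 h2, integral_sub (hμ.integrable.mul_const _)
    ((hμ.integrable_mul_id hlam).mul_const _), integral_mul_const, integral_mul_const,
    hμ.integral_mul_id, hμ.integral_eq_one, ← conv_apply, ← conv_apply]
  ring

theorem integrable_mul_incr_sq (hφ : Confining lam B K n φ) (hn : 1 ≤ n) (hlam : 0 < lam)
    (hμ : GaussDecay lam μ) (x : ℝ) :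
    Integrable (fun t => μ t * incr a φ x t ^ 2) volume := by
  have hbd : ∃ K', ∀ t, |incr a φ x t| ≤ K' * (1 + t ^ (2 * n)) := by
    have hsq : ∀ t : ℝ, t ^ 2 ≤ 1 + t ^ (2 * n) := fun t => by
      rw [pow_mul]
      rcases le_total (t ^ 2) 1 with h | h
      · have : 0 ≤ (t ^ 2) ^ n := by positivity
        linarith
      · have := le_self_pow₀ h (by omega : n ≠ 0)
        linarith
    refine ⟨K * (2 ^ (2 * n) * (1 + x ^ (2 * n))) + K * (2 ^ (2 * n) * (1 + 0 ^ (2 * n))) +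
      |a * x ^ 2| + |2 * a * x|, fun t => ?_⟩
    have h1 := hφ.growth_sub x t
    have h2 := hφ.growth_sub 0 t
    have h3 : (1 : ℝ) ≤ 1 + t ^ (2 * n) := by linarith [(even_two_mul n).pow_nonneg t]
    have h4 : |t| ≤ 1 + t ^ (2 * n) := by
      have : |t| ≤ max 1 (t ^ 2) := by
        rcases le_total |t| 1 with h | h
        · exact le_max_of_le_left h
        · refine le_max_of_le_right ?_
          rw [← sq_abs]
          nlinarith
      exact this.trans (max_le h3 (hsq t))
    have heq : incr a φ x t = φ (x - t) - φ (0 - t) - a * x ^ 2 + 2 * a * x * t := by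
      unfold incr
      rw [zero_sub]
      ring
    rw [heq]
    calc _ ≤ |φ (x - t)| + |φ (0 - t)| + |a * x ^ 2| + |2 * a * x * t| := by
          refine (abs_add_le _ _).trans ?_
          gcongr
          refine (abs_sub _ _).trans ?_
          gcongr
          exact abs_sub _ _
      _ ≤ _ := by
          rw [abs_mul (2 * a * x)]
          have h5 := mul_le_mul_of_nonneg_left h3 (abs_nonneg (a * x ^ 2))
          have h6 := mul_le_mul_of_nonneg_left h4 (abs_nonneg (2 * a * x))
          rw [mul_one] at h5
          linarith
  obtain ⟨K', hK'⟩ := hbd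
  have hc : Continuous fun t => incr a φ x t :=
    (continuous_incr hφ.continuous).comp (Continuous.prodMk_right x)
  refine hμ.integrable_mul_of_growth hlam (n := 2 * n) (K := 2 * K' ^ 2)
    (hc.pow 2).measurable fun t => ?_
  rw [abs_of_nonneg (sq_nonneg _), ← sq_abs]
  calc |incr a φ x t| ^ 2 ≤ (K' * (1 + t ^ (2 * n))) ^ 2 :=
        pow_le_pow_left₀ (abs_nonneg _) (hK' t) 2
    _ ≤ 2 * K' ^ 2 * (1 + t ^ (2 * (2 * n))) := by
        rw [show 2 * (2 * n) = 2 * n * 2 by ring, pow_mul t (2 * n) 2, mul_pow]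
        nlinarith [mul_nonneg (sq_nonneg K') (sq_nonneg (1 - t ^ (2 * n)))]

/-- The normalised difference of two potentials `φ ⋆ μ₁` and `φ ⋆ μ₀`. -/
theorem sq_conv_sub_le (hφ : Confining lam B K n φ) (hn : 1 ≤ n) (hlam : 0 < lam)
    (h₀ : GaussDecay lam μ₀) (h₁ : GaussDecay lam μ₁) (x : ℝ) :
    ((conv φ μ₁ x - conv φ μ₁ 0) - (conv φ μ₀ x - conv φ μ₀ 0)) ^ 2 ≤ hell μ₀ μ₁ *
      (2 * (∫ t, μ₀ t * incr a φ x t ^ 2) + 2 * ∫ t, μ₁ t * incr a φ x t ^ 2) := by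
  have hc : Continuous fun t => incr a φ x t :=
    (continuous_incr hφ.continuous).comp (Continuous.prodMk_right x)
  have h := (sq_integral_abs_sub_mul_le h₀.nonneg h₁.nonneg h₀.integrable h₁.integrable
    hc.aestronglyMeasurable (hφ.integrable_mul_incr_sq (a := a) hn hlam h₀ x)
    (hφ.integrable_mul_incr_sq hn hlam h₁ x)).2
  obtain ⟨i0, e0⟩ := hφ.integral_mul_incr (a := a) hlam h₀ x
  obtain ⟨i1, e1⟩ := hφ.integral_mul_incr (a := a) hlam h₁ x
  have heq : (conv φ μ₁ x - conv φ μ₁ 0) - (conv φ μ₀ x - conv φ μ₀ 0) =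
      ∫ t, (μ₁ t - μ₀ t) * incr a φ x t := by
    simp_rw [sub_mul]
    rw [integral_sub i1 i0, e0, e1]
    ring
  refine le_trans ?_ h
  rw [heq, ← sq_abs]
  exact pow_le_pow_left₀ (abs_nonneg _) abs_integral_le_integral_abs 2

/-- The constant is `2κ + 2κ`: each of the two terms of `sq_conv_sub_le` is integrated by
`lintegral_incr_sq_le`. With the factor `1/8` and the two densities in `hell_le_of_log_sub` it gives
exactly the rate `κ`. -/
theorem integral_sq_conv_sub_le (hφ : Confining lam B K n φ) (hn : 1 ≤ n) (hlam : 0 < lam)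
    (hc : Contractive lam κ a φ g) (h₀ : GaussDecay lam μ₀) (h₁ : GaussDecay lam μ₁)
    (hp : GaussDecay lam p) :
    Integrable (fun x => p x *
      ((conv φ μ₁ x - conv φ μ₁ 0) - (conv φ μ₀ x - conv φ μ₀ 0)) ^ 2) volume ∧
    ∫ x, p x * ((conv φ μ₁ x - conv φ μ₁ 0) - (conv φ μ₀ x - conv φ μ₀ 0)) ^ 2 ≤
      4 * κ * hell μ₀ μ₁ := by
  have hH := hell_nonneg μ₀ μ₁
  have hκ := hc.nonneg
  set A : ℝ → ℝ := fun x => (conv φ μ₁ x - conv φ μ₁ 0) - (conv φ μ₀ x - conv φ μ₀ 0) with hA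
  have hnn : ∀ x, 0 ≤ p x * A x ^ 2 := fun x => mul_nonneg (hp.nonneg x) (sq_nonneg _)
  have hm : AEStronglyMeasurable (fun x => p x * A x ^ 2) volume := by
    have e0 := aestronglyMeasurable_conv hφ.continuous h₀.integrable.1
    have e1 := aestronglyMeasurable_conv hφ.continuous h₁.integrable.1
    exact hp.integrable.1.mul (((e1.sub aestronglyMeasurable_const).sub
      (e0.sub aestronglyMeasurable_const)).pow 2)
  have hI : ∀ μ, GaussDecay lam μ → ∀ x, ENNReal.ofReal (∫ t, μ t * incr a φ x t ^ 2) =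
      ∫⁻ t, ENNReal.ofReal (μ t) * ENNReal.ofReal (incr a φ x t ^ 2) := fun μ hμ x =>
    (hμ.lintegral_mul_ofReal (fun t => sq_nonneg _)
      (hφ.integrable_mul_incr_sq hn hlam hμ x)).symm
  have hlin : ∫⁻ x, ENNReal.ofReal (p x * A x ^ 2) ≤ ENNReal.ofReal (4 * κ * hell μ₀ μ₁) := by
    have hx : ∀ x, ENNReal.ofReal (p x * A x ^ 2) ≤ ENNReal.ofReal (2 * hell μ₀ μ₁) *
        (ENNReal.ofReal (p x) * (∫⁻ t, ENNReal.ofReal (μ₀ t) * ENNReal.ofReal (incr a φ x t ^ 2)) +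
        ENNReal.ofReal (p x) *
          ∫⁻ t, ENNReal.ofReal (μ₁ t) * ENNReal.ofReal (incr a φ x t ^ 2)) := by
      intro x
      have hnn0 : ∀ μ, GaussDecay lam μ → 0 ≤ ∫ t, μ t * incr a φ x t ^ 2 := fun μ hμ =>
        integral_nonneg fun t => mul_nonneg (hμ.nonneg t) (sq_nonneg _)
      rw [← hI μ₀ h₀, ← hI μ₁ h₁, ← mul_add, ← ENNReal.ofReal_add (hnn0 _ h₀) (hnn0 _ h₁),
        ← ENNReal.ofReal_mul (hp.nonneg x), ← ENNReal.ofReal_mul (by positivity)]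
      apply ENNReal.ofReal_le_ofReal
      have := mul_le_mul_of_nonneg_left (hφ.sq_conv_sub_le (a := a) hn hlam h₀ h₁ x) (hp.nonneg x)
      refine this.trans (le_of_eq ?_)
      ring
    refine (lintegral_mono hx).trans ?_
    have hmeas : ∀ μ, GaussDecay lam μ → AEMeasurable (fun x => ENNReal.ofReal (p x) *
        ∫⁻ t, ENNReal.ofReal (μ t) * ENNReal.ofReal (incr a φ x t ^ 2)) volume := by
      intro μ hμ
      have hD : Measurable fun z : ℝ × ℝ => ENNReal.ofReal (incr a φ z.1 z.2 ^ 2) :=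
        ((continuous_incr hφ.continuous).pow 2).measurable.ennreal_ofReal
      exact hp.aemeasurable_ofReal.mul
        ((hμ.aemeasurable_ofReal.comp_quasiMeasurePreserving
        Measure.quasiMeasurePreserving_snd).mul hD.aemeasurable).lintegral_prod_right'
    rw [lintegral_const_mul' _ _ ENNReal.ofReal_ne_top, lintegral_add_left' (hmeas μ₀ h₀)]
    refine (mul_le_mul_right (add_le_add
      (hc.lintegral_incr_sq_le hφ.continuous hlam h₀ hp)
      (hc.lintegral_incr_sq_le hφ.continuous hlam h₁ hp)) _).trans (le_of_eq ?_)
    rw [← ENNReal.ofReal_add hκ hκ, ← ENNReal.ofReal_mul (by positivity)]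
    congr 1
    ring
  have hint : Integrable (fun x => p x * A x ^ 2) volume := by
    refine ⟨hm, ?_⟩
    rw [hasFiniteIntegral_iff_ofReal (Eventually.of_forall hnn)]
    exact hlin.trans_lt ENNReal.ofReal_lt_top
  refine ⟨hint, ?_⟩
  rw [← ofReal_integral_eq_lintegral_ofReal hint (Eventually.of_forall hnn)] at hlin
  exact (ENNReal.ofReal_le_ofReal_iff (by positivity)).1 hlin

end Confining

theorem log_gibbs_sub {φ₀ φ₁ μ₀ μ₁ : ℝ → ℝ}
    (h₀ : Integrable (fun y => Real.exp (-conv φ₀ μ₀ y)) volume)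
    (h₁ : Integrable (fun y => Real.exp (-conv φ₁ μ₁ y)) volume) :
    ∃ c, ∀ x, Real.log (gibbs φ₀ μ₀ x) - Real.log (gibbs φ₁ μ₁ x) =
      ((conv φ₁ μ₁ x - conv φ₁ μ₁ 0) - (conv φ₀ μ₀ x - conv φ₀ μ₀ 0)) + c := by
  have z0 := integral_exp_pos h₀
  have z1 := integral_exp_pos h₁
  refine ⟨Real.log (∫ z, Real.exp (-conv φ₁ μ₁ z)) - Real.log (∫ z, Real.exp (-conv φ₀ μ₀ z)) +
    conv φ₁ μ₁ 0 - conv φ₀ μ₀ 0, fun x => ?_⟩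
  unfold gibbs
  rw [Real.log_mul (inv_ne_zero z0.ne') (Real.exp_pos _).ne',
    Real.log_mul (inv_ne_zero z1.ne') (Real.exp_pos _).ne', Real.log_exp, Real.log_exp,
    Real.log_inv, Real.log_inv]
  ring

/-- The Gibbs map contracts the Hellinger distance. -/
theorem hell_gibbs_le {lam B K κ a : ℝ} {n : ℕ} {φ g μ₀ μ₁ : ℝ → ℝ}
    (hφ : Confining lam B K n φ) (hn : 1 ≤ n) (hlam : 0 < lam) (hc : Contractive lam κ a φ g)
    (h₀ : GaussDecay lam μ₀) (h₁ : GaussDecay lam μ₁) :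
    hell (gibbs φ μ₀) (gibbs φ μ₁) ≤ κ * hell μ₀ μ₁ := by
  have g0 := hφ.gaussDecay_gibbs hlam h₀
  have g1 := hφ.gaussDecay_gibbs hlam h₁
  obtain ⟨c, hW⟩ := log_gibbs_sub (hφ.exp_integrable hlam h₀) (hφ.exp_integrable hlam h₁)
  obtain ⟨i0, e0⟩ := hφ.integral_sq_conv_sub_le hn hlam hc h₀ h₁ g0
  obtain ⟨i1, e1⟩ := hφ.integral_sq_conv_sub_le hn hlam hc h₀ h₁ g1
  have h := hell_le_of_log_sub (hφ.gibbs_pos hlam h₀) (hφ.gibbs_pos hlam h₁) g0.integrable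
    g1.integrable (g0.integral_eq_one.trans g1.integral_eq_one.symm) hW
    (by simp only [add_mul]; exact i0.add i1)
  simp_rw [add_mul] at h
  rw [integral_add i0 i1] at h
  linarith

/-! ### Existence and uniqueness of the invariant density. -/

theorem ae_eq_of_hell_eq_zero {p q : ℝ → ℝ} (hp0 : ∀ x, 0 ≤ p x) (hq0 : ∀ x, 0 ≤ q x)
    (hp : Integrable p volume) (hq : Integrable q volume) (h : hell p q = 0) :
    p =ᵐ[volume] q := by
  have h1 := (integral_eq_zero_iff_of_nonneg (fun _ => sq_nonneg _)
    (integrable_hell hp0 hq0 hp hq)).1 h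
  filter_upwards [h1] with x hx
  have hx' : √(p x) = √(q x) := sub_eq_zero.1 (pow_eq_zero_iff two_ne_zero |>.1 hx)
  exact (Real.sqrt_inj (hp0 x) (hq0 x)).1 hx'

theorem gibbs_congr_ae {φ μ₀ μ₁ : ℝ → ℝ} (h : μ₀ =ᵐ[volume] μ₁) : gibbs φ μ₀ = gibbs φ μ₁ := by
  have : conv φ μ₀ = conv φ μ₁ := by
    ext y
    refine integral_congr_ae ?_
    filter_upwards [h] with t ht
    rw [ht]
  ext y
  simp only [gibbs, this]

theorem exists_gaussDecay {lam : ℝ} (hlam : 0 < lam) : ∃ p, GaussDecay lam p :=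
  ⟨_, gaussDecay_of_potential (lam := lam) (V := fun y => lam / 2 * y ^ 2)
    (fun y => by simp only [neg_sq])
    (by simpa only [neg_mul] using integrable_exp_neg_mul_sq (half_pos hlam))
    (fun u x _ _ => by linarith) fun _ => rfl⟩

variable {lam B K κ a : ℝ} {n : ℕ} {φ g : ℝ → ℝ}

/-- Contraction gives equality almost everywhere only. Equality at every point follows because the
Gibbs map does not see null sets and both densities are its fixed points. -/
theorem IsInvariantDensity.unique {π₀ π₁ : ℝ → ℝ} (hφ : Confining lam B K n φ) (hn : 1 ≤ n)
    (hlam : 0 < lam) (hc : Contractive lam κ a φ g) (hκ : κ < 1)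
    (h₀ : IsInvariantDensity φ π₀) (h₁ : IsInvariantDensity φ π₁) : π₀ = π₁ := by
  have d0 := h₀.gaussDecay hφ
  have d1 := h₁.gaussDecay hφ
  have h := hell_gibbs_le hφ hn hlam hc d0 d1
  rw [← h₀.eq_gibbs, ← h₁.eq_gibbs] at h
  have hz : hell π₀ π₁ = 0 := by
    have := hell_nonneg π₀ π₁
    nlinarith
  have hae := ae_eq_of_hell_eq_zero d0.nonneg d1.nonneg d0.integrable d1.integrable hz
  rw [h₀.eq_gibbs, h₁.eq_gibbs]
  exact gibbs_congr_ae hae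

/-- Turns Hellinger convergence into pointwise convergence of the potentials. The constant depends
on `x` but not on the densities, since their moments are uniformly bounded. -/
theorem Confining.exists_sq_conv_sub_le (hφ : Confining lam B K n φ) (hlam : 0 < lam) (x : ℝ) :
    ∃ M, 0 ≤ M ∧ ∀ μ₀ μ₁, GaussDecay lam μ₀ → GaussDecay lam μ₁ →
      |conv φ μ₁ x - conv φ μ₀ x| ^ 2 ≤ hell μ₀ μ₁ * M := by
  set L := K * (2 ^ (2 * n) * (1 + x ^ (2 * n)))
  have hL : ∀ t, φ (x - t) ^ 2 ≤ 2 * L ^ 2 * (1 + t ^ (2 * (2 * n))) := fun t => by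
    rw [← sq_abs]
    calc |φ (x - t)| ^ 2 ≤ (L * (1 + t ^ (2 * n))) ^ 2 :=
          pow_le_pow_left₀ (abs_nonneg _) (hφ.growth_sub x t) 2
      _ ≤ _ := by
          rw [show 2 * (2 * n) = 2 * n * 2 by ring, pow_mul t (2 * n) 2, mul_pow]
          nlinarith [mul_nonneg (sq_nonneg L) (sq_nonneg (1 - t ^ (2 * n)))]
  have hm := gaussMoment_nonneg hlam (2 * n)
  have hcont : Continuous fun t => φ (x - t) := hφ.continuous.comp (by fun_prop)
  have hi : ∀ μ, GaussDecay lam μ → Integrable (fun t => μ t * φ (x - t) ^ 2) volume :=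
    fun μ hμ => hμ.integrable_mul_of_growth hlam (hcont.pow 2).measurable fun t => by
      rw [abs_of_nonneg (sq_nonneg _)]
      exact hL t
  have hb : ∀ μ, GaussDecay lam μ →
      ∫ t, μ t * φ (x - t) ^ 2 ≤ 2 * L ^ 2 * (1 + gaussMoment lam (2 * n)) := fun μ hμ => by
    have hi2 : Integrable (fun t => 2 * L ^ 2 * (μ t + μ t * t ^ (2 * (2 * n)))) volume :=
      (hμ.integrable.add (hμ.integrable_mul_pow hlam (2 * n))).const_mul _
    calc _ ≤ ∫ t, 2 * L ^ 2 * (μ t + μ t * t ^ (2 * (2 * n))) := by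
          refine integral_mono (hi μ hμ) hi2 fun t => ?_
          refine (mul_le_mul_of_nonneg_left (hL t) (hμ.nonneg t)).trans (le_of_eq ?_)
          ring
      _ ≤ _ := by
          rw [integral_const_mul, integral_add hμ.integrable (hμ.integrable_mul_pow hlam _),
            hμ.integral_eq_one]
          gcongr
          exact hμ.integral_mul_pow_le hlam _
  refine ⟨4 * (2 * L ^ 2 * (1 + gaussMoment lam (2 * n))), by positivity,
    fun μ₀ μ₁ h₀ h₁ => ?_⟩
  have h := (sq_integral_abs_sub_mul_le h₀.nonneg h₁.nonneg h₀.integrable h₁.integrable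
    hcont.aestronglyMeasurable (hi _ h₀) (hi _ h₁)).2
  have heq : conv φ μ₁ x - conv φ μ₀ x = ∫ t, (μ₁ t - μ₀ t) * φ (x - t) := by
    simp_rw [sub_mul]
    rw [integral_sub (hφ.integrable_conv hlam h₁ x) (hφ.integrable_conv hlam h₀ x),
      conv_apply, conv_apply]
  rw [heq]
  refine (pow_le_pow_left₀ (abs_nonneg _) abs_integral_le_integral_abs 2).trans (h.trans ?_)
  refine mul_le_mul_of_nonneg_left ?_ (hell_nonneg _ _)
  linarith [hb _ h₀, hb _ h₁]

/-- Existence of an invariant density by Picard iteration of the Gibbs map. -/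
theorem exists_isInvariantDensity (hφ : Confining lam B K n φ) (hn : 1 ≤ n) (hlam : 0 < lam)
    (hc : Contractive lam κ a φ g) (hκ : κ < 1) : ∃ π, IsInvariantDensity φ π := by
  obtain ⟨μ, hμ⟩ := exists_gaussDecay hlam
  set u : ℕ → ℝ → ℝ := fun k => (gibbs φ)^[k] μ with hu
  have hsucc : ∀ k, u (k + 1) = gibbs φ (u k) := fun k => Function.iterate_succ_apply' _ _ _
  have hdec : ∀ k, GaussDecay lam (u k) := by
    intro k
    induction k with
    | zero => exact hμ
    | succ k ih => exact hsucc k ▸ hφ.gaussDecay_gibbs hlam ih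
  have hell_le : ∀ k, hell (u k) (u (k + 1)) ≤ κ ^ k * hell (u 0) (u 1) := by
    intro k
    induction k with
    | zero => simp
    | succ k ih =>
      have h1 := hell_gibbs_le hφ hn hlam hc (hdec k) (hdec (k + 1))
      rw [← hsucc, ← hsucc] at h1
      calc _ ≤ _ := h1
        _ ≤ κ * (κ ^ k * hell (u 0) (u 1)) := mul_le_mul_of_nonneg_left ih hc.nonneg
        _ = _ := by ring
  have hlim : ∀ x, ∃ v, Tendsto (fun k => conv φ (u k) x) atTop (nhds v) := by
    intro x
    obtain ⟨M, hM0, hM⟩ := hφ.exists_sq_conv_sub_le hlam x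
    have hκ' : √κ < 1 := by rwa [Real.sqrt_lt' one_pos, one_pow]
    refine cauchySeq_tendsto_of_complete
      (cauchySeq_of_le_geometric (√κ) (√(hell (u 0) (u 1) * M)) hκ' fun k => ?_)
    rw [dist_comm, Real.dist_eq]
    refine abs_le_of_sq_le_sq' ?_ (by positivity) |>.2
    rw [mul_pow, Real.sq_sqrt (mul_nonneg (hell_nonneg _ _) hM0), ← pow_mul, mul_comm k 2,
      pow_mul, Real.sq_sqrt hc.nonneg]
    calc _ ≤ _ := hM _ _ (hdec k) (hdec (k + 1))
      _ ≤ κ ^ k * hell (u 0) (u 1) * M := mul_le_mul_of_nonneg_right (hell_le k) hM0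
      _ = _ := by ring
  choose V hV using hlim
  have hVeven : Function.Even V := fun x =>
    tendsto_nhds_unique (hV (-x)) (by
      simpa only [conv_even hφ.even (hdec _).even x] using hV x)
  have hexp : ∀ x, Tendsto (fun k => Real.exp (-conv φ (u k) x)) atTop
      (nhds (Real.exp (-V x))) := fun x =>
    (Real.continuous_exp.tendsto _).comp (hV x).neg
  have hbound : Integrable (fun x => Real.exp B * Real.exp (-(lam / 2) * x ^ 2)) volume :=
    (integrable_exp_neg_mul_sq (half_pos hlam)).const_mul _
  have hmeas : ∀ k, AEStronglyMeasurable (fun x => Real.exp (-conv φ (u k) x)) volume :=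
    fun k => (hφ.exp_integrable hlam (hdec k)).1
  have hle : ∀ k x, ‖Real.exp (-conv φ (u k) x)‖ ≤
      Real.exp B * Real.exp (-(lam / 2) * x ^ 2) := fun k x => by
    rw [Real.norm_eq_abs, Real.abs_exp]
    exact hφ.exp_conv_le hlam (hdec k) x
  have hint : Integrable (fun x => Real.exp (-V x)) volume := by
    refine hbound.mono' (aestronglyMeasurable_of_tendsto_ae atTop hmeas
      (Eventually.of_forall hexp)) (Eventually.of_forall fun x => ?_)
    exact le_of_tendsto (hexp x).norm (Eventually.of_forall fun k => hle k x)
  have hZ : Tendsto (fun k => ∫ x, Real.exp (-conv φ (u k) x)) atTop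
      (nhds (∫ x, Real.exp (-V x))) :=
    tendsto_integral_of_dominated_convergence _ hmeas hbound
      (fun k => Eventually.of_forall (hle k)) (Eventually.of_forall hexp)
  have hZpos : 0 < ∫ x, Real.exp (-V x) := integral_exp_pos hint
  have hinv : Tendsto (fun k => (∫ x, Real.exp (-conv φ (u k) x))⁻¹) atTop
      (nhds (∫ x, Real.exp (-V x))⁻¹) := hZ.inv₀ hZpos.ne'
  set π : ℝ → ℝ := fun y => (∫ x, Real.exp (-V x))⁻¹ * Real.exp (-V y) with hπ
  have hπdec : GaussDecay lam π := by
    refine gaussDecay_of_potential hVeven hint (fun s x hs hsx => ?_) fun _ => rfl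
    exact le_of_tendsto_of_tendsto ((hV s).add_const _) (hV x)
      (Eventually.of_forall fun k => hφ.conv_increment' hlam (hdec k) hs hsx)
  -- The inverse normalising constants converge, hence are bounded. So the iterates `u (k + 1)` lie
  -- below one Gaussian, and dominated convergence identifies the limit of the convolutions.
  obtain ⟨Mi, hMi⟩ := hinv.bddAbove_range
  have hconv : ∀ x, Tendsto (fun k => conv φ (u (k + 1)) x) atTop (nhds (conv φ π x)) := by
    intro x
    have hγ : Integrable (fun t => Mi * Real.exp B *
        (Real.exp (-(lam / 2) * t ^ 2) * |φ (x - t)|)) volume := by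
      refine Integrable.const_mul ?_ _
      -- Integrability of the Gaussian weight times `φ(x - ·)` is read off from that of a normalised
      -- Gaussian density by multiplying its normalising constant back.
      have h1 := hφ.integrable_conv hlam
        (gaussDecay_of_potential (lam := lam) (V := fun y => lam / 2 * y ^ 2)
          (fun y => by simp only [neg_sq])
          (by simpa only [neg_mul] using integrable_exp_neg_mul_sq (half_pos hlam))
          (fun u x _ _ => by linarith) fun _ => rfl) x
      have hz := (integral_exp_pos (μ := volume) (f := fun y : ℝ => -(lam / 2 * y ^ 2))
        (by simpa only [neg_mul] using integrable_exp_neg_mul_sq (half_pos hlam))).ne'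
      refine ((h1.const_mul (∫ z, Real.exp (-(lam / 2 * z ^ 2)))).abs).congr
        (Eventually.of_forall fun t => ?_)
      simp only [← mul_assoc, mul_inv_cancel₀ hz, one_mul, abs_mul, Real.abs_exp, neg_mul]
    refine tendsto_integral_of_dominated_convergence _
      (fun k => (hφ.integrable_conv hlam (hdec (k + 1)) x).1) hγ
      (fun k => Eventually.of_forall fun t => ?_) (Eventually.of_forall fun t => ?_)
    · change ‖u (k + 1) t * φ (x - t)‖ ≤ _
      rw [Real.norm_eq_abs, abs_mul, abs_of_nonneg ((hdec (k + 1)).nonneg t), ← mul_assoc]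
      refine mul_le_mul_of_nonneg_right ?_ (abs_nonneg _)
      rw [hsucc, mul_assoc]
      have hnn : 0 ≤ (∫ x, Real.exp (-conv φ (u k) x))⁻¹ :=
        inv_nonneg.2 (integral_nonneg fun _ => (Real.exp_pos _).le)
      exact mul_le_mul (hMi ⟨k, rfl⟩) (hφ.exp_conv_le hlam (hdec k) t) (Real.exp_pos _).le
        (hnn.trans (hMi ⟨k, rfl⟩))
    · change Tendsto (fun k => u (k + 1) t * φ (x - t)) atTop (nhds (π t * φ (x - t)))
      simp_rw [hsucc]
      exact (hinv.mul (hexp t)).mul_const _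
  have hVeq : V = conv φ π := funext fun x =>
    tendsto_nhds_unique ((tendsto_add_atTop_iff_nat 1).2 (hV x)) (hconv x)
  refine ⟨π, hφ.isInvariantDensity_of_eq_gibbs hlam hπdec ?_⟩
  ext y
  unfold gibbs
  rw [← hVeq]

theorem existsUnique_isInvariantDensity (hφ : Confining lam B K n φ) (hn : 1 ≤ n)
    (hlam : 0 < lam) (hc : Contractive lam κ a φ g) (hκ : κ < 1) :
    ∃! π, IsInvariantDensity φ π :=
  let ⟨π, hπ⟩ := exists_isInvariantDensity hφ hn hlam hc hκ
  ⟨π, hπ, fun _ h => h.unique hφ hn hlam hc hκ hπ⟩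

end McKeanVlasov

/-! ### The perturbed polynomial potential is confining and contractive. -/

namespace McKeanVlasov

/-- In the even binomial expansion every term is non-decreasing on `[0, ∞)`, and the top term alone
accounts for the gain `2(x^(2j) - u^(2j))`. -/
theorem symm_pow_increment (j : ℕ) (t : ℝ) {u x : ℝ} (hu : 0 ≤ u) (hux : u ≤ x) :
    (u - t) ^ (2 * j) + (u + t) ^ (2 * j) + 2 * (x ^ (2 * j) - u ^ (2 * j)) ≤
      (x - t) ^ (2 * j) + (x + t) ^ (2 * j) := by
  rw [sub_pow_add_add_pow, sub_pow_add_add_pow, sum_range_succ, sum_range_succ]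
  have h : ∑ i ∈ range j, ((2 * j).choose (2 * i) : ℝ) * u ^ (2 * i) * t ^ (2 * (j - i)) ≤
      ∑ i ∈ range j, ((2 * j).choose (2 * i) : ℝ) * x ^ (2 * i) * t ^ (2 * (j - i)) := by
    refine sum_le_sum fun i _ => ?_
    have ht := (even_two_mul (j - i)).pow_nonneg t
    gcongr
  simp only [Nat.choose_self, Nat.cast_one, one_mul, Nat.sub_self, mul_zero, pow_zero, mul_one]
  linarith

/-- Bounds on a perturbation `β` of the polynomial potential. -/
structure Perturbation (B ε c : ℝ) (β : ℝ → ℝ) : Prop where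
  contDiff : ContDiff ℝ 2 β
  even : Function.Even β
  bound_zero : ∀ y, |β y| ≤ B
  bound_one : ∀ y, |deriv β y| ≤ ε
  lower_two : ∀ y, -c ≤ iteratedDeriv 2 β y

namespace Perturbation

variable {B ε c : ℝ} {β : ℝ → ℝ}

theorem convexOn (h : Perturbation B ε c β) :
    ConvexOn ℝ Set.univ fun y => β y + c / 2 * y ^ 2 := by
  have hd : Differentiable ℝ β := h.contDiff.differentiable (by norm_num)
  have hd1 : Differentiable ℝ (deriv β) :=
    (h.contDiff.differentiable_deriv_two)
  have hder : deriv (fun y => β y + c / 2 * y ^ 2) = fun y => deriv β y + c * y := by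
    ext y
    rw [deriv_fun_add (hd y) (by fun_prop)]
    simp
    ring
  refine convexOn_of_deriv2_nonneg' convex_univ ?_ ?_ fun y _ => ?_
  · exact (hd.add (by fun_prop)).differentiableOn
  · rw [hder]
    exact (hd1.add (by fun_prop)).differentiableOn
  · rw [Function.iterate_succ, Function.iterate_one, Function.comp_apply, hder,
      deriv_fun_add (hd1 y) (by fun_prop)]
    have := h.lower_two y
    rw [iteratedDeriv_succ, iteratedDeriv_one] at this
    simp
    linarith

/-- For `x > 0`, `u` is a convex combination of `x` and `-x`. Convexity of `β + c y²/2` at the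
points translated by `t` and by `-t`, added together, gives the claim because evenness identifies
the four endpoints in pairs. -/
theorem symm_increment (h : Perturbation B ε c β) (t : ℝ) {u x : ℝ} (hu : 0 ≤ u) (hux : u ≤ x) :
    β (u - t) + β (u + t) - c * (x ^ 2 - u ^ 2) ≤ β (x - t) + β (x + t) := by
  rcases hu.eq_or_lt with rfl | hu'
  · rcases hux.eq_or_lt with rfl | hx
    · simp
    · have h1 := h.convexOn.2 (Set.mem_univ (x - t)) (Set.mem_univ (-x - t))
        (by norm_num : (0 : ℝ) ≤ 1 / 2) (by norm_num : (0 : ℝ) ≤ 1 / 2) (by norm_num)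
      have h2 := h.convexOn.2 (Set.mem_univ (x + t)) (Set.mem_univ (-x + t))
        (by norm_num : (0 : ℝ) ≤ 1 / 2) (by norm_num : (0 : ℝ) ≤ 1 / 2) (by norm_num)
      simp only [smul_eq_mul] at h1 h2
      rw [show 1 / 2 * (x - t) + 1 / 2 * (-x - t) = 0 - t by ring,
        show -x - t = -(x + t) by ring, h.even] at h1
      rw [show 1 / 2 * (x + t) + 1 / 2 * (-x + t) = 0 + t by ring,
        show -x + t = -(x - t) by ring, h.even] at h2
      linarith
  · have hx : 0 < x := hu'.trans_le hux
    have hθ0 : 0 ≤ (x - u) / (2 * x) := div_nonneg (by linarith) (by linarith)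
    have hθ1 : 0 ≤ (x + u) / (2 * x) := div_nonneg (by linarith) (by linarith)
    have hθ : (x + u) / (2 * x) + (x - u) / (2 * x) = 1 := by
      field_simp
      ring
    have hθu : (x + u) / (2 * x) * x - (x - u) / (2 * x) * x = u := by
      field_simp
      ring
    have h1 := h.convexOn.2 (Set.mem_univ (x - t)) (Set.mem_univ (-x - t)) hθ1 hθ0 hθ
    have h2 := h.convexOn.2 (Set.mem_univ (x + t)) (Set.mem_univ (-x + t)) hθ1 hθ0 hθ
    simp only [smul_eq_mul] at h1 h2
    generalize (x - u) / (2 * x) = θ at *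
    generalize (x + u) / (2 * x) = θ' at *
    obtain rfl : θ' = 1 - θ := by linarith
    rw [show (1 - θ) * (x - t) + θ * (-x - t) = u - t by linear_combination hθu,
      show -x - t = -(x + t) by ring, h.even] at h1
    rw [show (1 - θ) * (x + t) + θ * (-x + t) = u + t by linear_combination hθu,
      show -x + t = -(x - t) by ring, h.even] at h2
    linarith

end Perturbation

theorem potential_even {J : ℕ} {a : ℕ → ℝ} {β : ℝ → ℝ} (hβ : Function.Even β) :
    Function.Even (potential J a β) := by
  intro y
  simp only [potential, (even_two_mul _).neg_pow, hβ y]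

section

variable {J : ℕ} {a : ℕ → ℝ} {lam B ε : ℝ} {β : ℝ → ℝ}

theorem pow_two_mul_le {j n : ℕ} (hjn : j ≤ n) (y : ℝ) : y ^ (2 * j) ≤ 1 + y ^ (2 * n) := by
  rw [pow_mul, pow_mul]
  rcases le_total (y ^ 2) 1 with h | h
  · have h1 := pow_le_one₀ (n := j) (sq_nonneg y) h
    have h2 : 0 ≤ (y ^ 2) ^ n := by positivity
    linarith
  · have := pow_le_pow_right₀ h hjn
    linarith

theorem symm_sum_increment (ha : ∀ j ∈ Icc 1 J, 0 ≤ a j) (t : ℝ) {u x : ℝ} (hu : 0 ≤ u)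
    (hux : u ≤ x) :
    ∑ j ∈ Icc 1 J, a j * (u - t) ^ (2 * j) + ∑ j ∈ Icc 1 J, a j * (u + t) ^ (2 * j) +
      2 * (∑ j ∈ Icc 1 J, a j * (x ^ (2 * j) - u ^ (2 * j))) ≤
      ∑ j ∈ Icc 1 J, a j * (x - t) ^ (2 * j) + ∑ j ∈ Icc 1 J, a j * (x + t) ^ (2 * j) := by
  rw [mul_sum, ← sum_add_distrib, ← sum_add_distrib, ← sum_add_distrib]
  refine sum_le_sum fun j hj => ?_
  have := mul_le_mul_of_nonneg_left (symm_pow_increment j t hu hux) (ha j hj)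
  linarith

theorem symm_potential_increment (ha : ∀ j ∈ Icc 1 J, 0 ≤ a j) {c : ℝ}
    (hβ : Perturbation B ε c β) (t : ℝ) {u x : ℝ} (hu : 0 ≤ u) (hux : u ≤ x) :
    potential J a β (u - t) + potential J a β (u + t) +
      2 * (∑ j ∈ Icc 1 J, a j * (x ^ (2 * j) - u ^ (2 * j))) - c * (x ^ 2 - u ^ 2) ≤
      potential J a β (x - t) + potential J a β (x + t) := by
  have h := symm_sum_increment ha t hu hux
  have := hβ.symm_increment t hu hux
  unfold potential
  linarith

theorem confining_potential (hJ : 1 ≤ J) (ha : ∀ j ∈ Icc 1 J, 0 ≤ a j)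
    (hβ : Perturbation B ε (C₂ a lam) β) :
    Confining lam B (∑ j ∈ Icc 1 J, a j + B) J (potential J a β) where
  continuous := by
    have := hβ.contDiff.continuous
    unfold potential
    fun_prop
  even := potential_even hβ.even
  lower := fun y => by
    have h1 : 0 ≤ ∑ j ∈ Icc 1 J, a j * y ^ (2 * j) :=
      sum_nonneg fun j hj => mul_nonneg (ha j hj) ((even_two_mul j).pow_nonneg y)
    have h2 := (abs_le.1 (hβ.bound_zero y)).1
    unfold potential
    linarith
  growth := fun y => by
    have hy := (even_two_mul J).pow_nonneg y
    have hB := (abs_nonneg _).trans (hβ.bound_zero y)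
    have h0 : 0 ≤ ∑ j ∈ Icc 1 J, a j * y ^ (2 * j) :=
      sum_nonneg fun j hj => mul_nonneg (ha j hj) ((even_two_mul j).pow_nonneg y)
    have h1 : ∑ j ∈ Icc 1 J, a j * y ^ (2 * j) ≤ (∑ j ∈ Icc 1 J, a j) * (1 + y ^ (2 * J)) := by
      rw [sum_mul]
      exact sum_le_sum fun j hj =>
        mul_le_mul_of_nonneg_left (pow_two_mul_le (mem_Icc.1 hj).2 y) (ha j hj)
    unfold potential
    refine (abs_add_le _ _).trans ?_
    rw [abs_of_nonneg h0, add_mul]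
    refine add_le_add h1 ((hβ.bound_zero y).trans ?_)
    nlinarith
  mono := fun t u x hu hux => by
    have h := symm_potential_increment ha hβ t hu hux
    have h1 : a 1 * (x ^ (2 * 1) - u ^ (2 * 1)) ≤
        ∑ j ∈ Icc 1 J, a j * (x ^ (2 * j) - u ^ (2 * j)) :=
      single_le_sum (f := fun j => a j * (x ^ (2 * j) - u ^ (2 * j)))
        (fun j hj => mul_nonneg (ha j hj) (sub_nonneg.2 (pow_le_pow_left₀ hu hux _)))
        (mem_Icc.2 ⟨le_rfl, hJ⟩)
    rw [mul_one] at h1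
    unfold C₂ at h
    linarith

/-- The sum in the definition of `C₁`. -/
noncomputable def polyRate (J : ℕ) (a : ℕ → ℝ) (lam : ℝ) : ℝ :=
  ∑ j ∈ Icc 2 J, 2 * (j : ℝ) * cCoef j * a j / lam ^ j

theorem cCoef_sq (j : ℕ) : cCoef j ^ 2 =
    2 * (Nat.factorial (2 * (2 * j - 1)) : ℝ) / (Nat.factorial (2 * j - 1) : ℝ) :=
  Real.sq_sqrt (by positivity)

theorem cCoef_pos (j : ℕ) : 0 < cCoef j := Real.sqrt_pos.2 (by positivity)

theorem polyRate_term_nonneg (ha : ∀ j ∈ Icc 1 J, 0 ≤ a j) (hlam : 0 < lam) :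
    ∀ j ∈ Icc 2 J, 0 ≤ 2 * (j : ℝ) * cCoef j * a j / lam ^ j := fun j hj => by
  have h1 := ha j (mem_Icc.2 ⟨by linarith [(mem_Icc.1 hj).1], (mem_Icc.1 hj).2⟩)
  have h2 := cCoef_pos j
  positivity

/-- The non-linear part of the derivative of the potential. -/
noncomputable def force (J : ℕ) (a : ℕ → ℝ) (β : ℝ → ℝ) (y : ℝ) : ℝ :=
  ∑ j ∈ Icc 2 J, 2 * (j : ℝ) * a j * y ^ (2 * j - 1) + deriv β y

theorem hasDerivAt_potential (hJ : 1 ≤ J) (hβ : Differentiable ℝ β) (y : ℝ) :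
    HasDerivAt (potential J a β) (2 * a 1 * y + force J a β y) y := by
  have h : HasDerivAt (potential J a β)
      (∑ j ∈ Icc 1 J, a j * ((2 * j : ℕ) * y ^ (2 * j - 1)) + deriv β y) y :=
    (HasDerivAt.fun_sum fun j _ => (hasDerivAt_pow (2 * j) y).const_mul (a j)).add
      (hβ y).hasDerivAt
  refine h.congr_deriv ?_
  rw [← insert_Icc_add_one_left_eq_Icc hJ, sum_insert (by simp)]
  unfold force
  push_cast
  have : ∀ j : ℕ, a j * (2 * (j : ℝ) * y ^ (2 * j - 1)) =
      2 * (j : ℝ) * a j * y ^ (2 * j - 1) := fun j => by ring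
  simp_rw [this]
  norm_num
  ring

/-- Cauchy-Schwarz with the weights `2 j c_j a_j / lam^j`, whose sum is `polyRate`. These weights
make the expectation of each term proportional to its own weight in `contractive_potential`. -/
theorem force_sq_le (ha : ∀ j ∈ Icc 1 J, 0 ≤ a j) (hlam : 0 < lam)
    (hε : ∀ y, |deriv β y| ≤ ε) (y : ℝ) :
    force J a β y ^ 2 ≤ ∑ j ∈ Icc 2 J, 2 * polyRate J a lam *
      ((2 * (j : ℝ) * a j) ^ 2 / (2 * (j : ℝ) * cCoef j * a j / lam ^ j)) * y ^ (2 * (2 * j - 1)) +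
      2 * ε ^ 2 := by
  have h1 : (∑ j ∈ Icc 2 J, 2 * (j : ℝ) * a j * y ^ (2 * j - 1)) ^ 2 ≤ polyRate J a lam *
      ∑ j ∈ Icc 2 J, (2 * (j : ℝ) * a j) ^ 2 / (2 * (j : ℝ) * cCoef j * a j / lam ^ j) *
        y ^ (2 * (2 * j - 1)) := by
    unfold polyRate
    refine sum_sq_le_sum_mul_sum_of_sq_le_mul _ (polyRate_term_nonneg ha hlam)
      (fun j hj => ?_) fun j hj => ?_
    · exact mul_nonneg (div_nonneg (sq_nonneg _) (polyRate_term_nonneg ha hlam j hj))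
        ((even_two_mul _).pow_nonneg y)
    -- When `a j = 0` the denominator vanishes too; the quotient is `0` by convention and both sides
    -- are zero.
    · rcases eq_or_ne (a j) 0 with h0 | h0
      · simp [h0]
      · have hj0 : (j : ℝ) ≠ 0 := by
          have := (mem_Icc.1 hj).1
          positivity
        have hc := (cCoef_pos j).ne'
        have hl := hlam.ne'
        refine le_of_eq ?_
        rw [pow_mul' y 2]
        field_simp
  have h2 : deriv β y ^ 2 ≤ ε ^ 2 := by
    rw [← sq_abs]
    exact pow_le_pow_left₀ (abs_nonneg _) (hε y) 2
  have h3 : ∑ j ∈ Icc 2 J, 2 * polyRate J a lam *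
      ((2 * (j : ℝ) * a j) ^ 2 / (2 * (j : ℝ) * cCoef j * a j / lam ^ j)) *
        y ^ (2 * (2 * j - 1)) = 2 * (polyRate J a lam *
      ∑ j ∈ Icc 2 J, (2 * (j : ℝ) * a j) ^ 2 / (2 * (j : ℝ) * cCoef j * a j / lam ^ j) *
        y ^ (2 * (2 * j - 1))) := by
    rw [mul_sum, mul_sum]
    exact sum_congr rfl fun j _ => by ring
  rw [h3]
  unfold force
  nlinarith [sq_nonneg (∑ j ∈ Icc 2 J, 2 * (j : ℝ) * a j * y ^ (2 * j - 1) - deriv β y)]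

theorem GaussDecay.lintegral_lintegral_polynomial_le {p q : ℝ → ℝ} (hp : GaussDecay lam p)
    (hq : GaussDecay lam q) (hlam : 0 < lam) (s : Finset ℕ) (m : ℕ → ℕ) (w : ℕ → ℝ)
    (hw : ∀ j ∈ s, 0 ≤ w j) {e : ℝ} (he : 0 ≤ e) :
    ∫⁻ t, ENNReal.ofReal (q t) * ∫⁻ x, ENNReal.ofReal (p x) *
        ENNReal.ofReal (∑ j ∈ s, w j * (x - t) ^ (2 * m j) + e) ≤
      ENNReal.ofReal (∑ j ∈ s,
        w j * ((Nat.factorial (2 * m j) : ℝ) / Nat.factorial (m j) / lam ^ m j) + e) := by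
  classical
  induction s using Finset.induction_on with
  | empty =>
    simp [lintegral_mul_const'' _ hp.aemeasurable_ofReal, hp.lintegral_eq_one,
      lintegral_mul_const'' _ hq.aemeasurable_ofReal, hq.lintegral_eq_one]
  | insert i s hi ih =>
    have ih := ih fun j hj => hw j (mem_insert_of_mem hj)
    have hwi := hw i (mem_insert_self i s)
    have hpos : ∀ x t : ℝ, 0 ≤ ∑ j ∈ s, w j * (x - t) ^ (2 * m j) + e := fun x t =>
      add_nonneg (sum_nonneg fun j hj => mul_nonneg (hw j (mem_insert_of_mem hj))
        ((even_two_mul _).pow_nonneg _)) he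
    have hpos' : ∀ x t : ℝ, 0 ≤ w i * (x - t) ^ (2 * m i) := fun x t =>
      mul_nonneg hwi ((even_two_mul _).pow_nonneg _)
    have hfac : 0 ≤ w i * ((Nat.factorial (2 * m i) : ℝ) / Nat.factorial (m i) / lam ^ m i) := by
      positivity
    have hsum0 : 0 ≤ ∑ j ∈ s,
        w j * ((Nat.factorial (2 * m j) : ℝ) / Nat.factorial (m j) / lam ^ m j) + e :=
      add_nonneg (sum_nonneg fun j hj => mul_nonneg (hw j (mem_insert_of_mem hj))
        (by positivity)) he
    have hinner : ∀ t : ℝ, ENNReal.ofReal (q t) * ∫⁻ x, ENNReal.ofReal (p x) *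
        ENNReal.ofReal (∑ j ∈ insert i s, w j * (x - t) ^ (2 * m j) + e) =
        ENNReal.ofReal (w i) * (ENNReal.ofReal (q t) *
          ∫⁻ x, ENNReal.ofReal (p x) * ENNReal.ofReal ((x - t) ^ (2 * m i))) +
        ENNReal.ofReal (q t) * ∫⁻ x, ENNReal.ofReal (p x) *
          ENNReal.ofReal (∑ j ∈ s, w j * (x - t) ^ (2 * m j) + e) := by
      intro t
      simp_rw [sum_insert hi, add_assoc, ENNReal.ofReal_add (hpos' _ t) (hpos _ t), mul_add,
        ENNReal.ofReal_mul hwi]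
      have hm : AEMeasurable (fun x => ENNReal.ofReal (p x) *
          (ENNReal.ofReal (w i) * ENNReal.ofReal ((x - t) ^ (2 * m i)))) volume :=
        hp.aemeasurable_ofReal.mul (by fun_prop)
      rw [lintegral_add_left' hm, mul_add]
      congr 1
      rw [mul_left_comm]
      congr 1
      rw [← lintegral_const_mul' _ _ ENNReal.ofReal_ne_top]
      exact lintegral_congr fun x => by ring
    have hmeas : AEMeasurable (fun t => ENNReal.ofReal (w i) * (ENNReal.ofReal (q t) *
          ∫⁻ x, ENNReal.ofReal (p x) * ENNReal.ofReal ((x - t) ^ (2 * m i)))) volume := by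
      refine (hq.aemeasurable_ofReal.mul ?_).const_mul _
      have hm2 : Measurable fun z : ℝ × ℝ => ENNReal.ofReal ((z.2 - z.1) ^ (2 * m i)) := by
        fun_prop
      exact ((hp.aemeasurable_ofReal.comp_quasiMeasurePreserving
        Measure.quasiMeasurePreserving_snd).mul hm2.aemeasurable).lintegral_prod_right'
    simp_rw [hinner]
    rw [lintegral_add_left' hmeas, lintegral_const_mul' _ _ ENNReal.ofReal_ne_top,
      sum_insert hi, add_assoc, ENNReal.ofReal_add hfac hsum0, ENNReal.ofReal_mul hwi]
    exact add_le_add (mul_le_mul_right (hp.lintegral_lintegral_sub_pow_le hq hlam _) _) ih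

/-- With `m = 2j - 1`, the bound `(2m)!/m!/lam^m` on `E (X - Y)^(2m)` equals `c_j²/(2 lam^m)`, which
is where `c_j` comes from. Each term of `force_sq_le` then becomes `lam * polyRate` times its
weight, and the sum is `lam * polyRate²`. -/
theorem contractive_potential (hJ : 1 ≤ J) (ha : ∀ j ∈ Icc 1 J, 0 ≤ a j) (hlam : 0 < lam)
    {c κ : ℝ} (hβ : Perturbation B ε c β) (hκ : lam * polyRate J a lam ^ 2 + 2 * ε ^ 2 ≤ lam * κ) :
    Contractive lam κ (a 1) (potential J a β) (force J a β) where
  hasDerivAt := hasDerivAt_potential hJ (hβ.contDiff.differentiable (by norm_num))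
  continuous := by
    have : Continuous (deriv β) := hβ.contDiff.continuous_deriv (by norm_num)
    unfold force
    fun_prop
  nonneg := by
    have : 0 ≤ lam * κ := le_trans (by positivity) hκ
    exact nonneg_of_mul_nonneg_right this hlam
  energy := fun μ p hμ hp => by
    have hS : 0 ≤ polyRate J a lam := sum_nonneg (polyRate_term_nonneg ha hlam)
    have hw : ∀ j ∈ Icc 2 J, 0 ≤ 2 * polyRate J a lam *
        ((2 * (j : ℝ) * a j) ^ 2 / (2 * (j : ℝ) * cCoef j * a j / lam ^ j)) := fun j hj =>
      mul_nonneg (by positivity) (div_nonneg (sq_nonneg _) (polyRate_term_nonneg ha hlam j hj))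
    calc _ ≤ ∫⁻ t, ENNReal.ofReal (μ t) * ∫⁻ x, ENNReal.ofReal (p x) *
          ENNReal.ofReal (∑ j ∈ Icc 2 J, 2 * polyRate J a lam *
            ((2 * (j : ℝ) * a j) ^ 2 / (2 * (j : ℝ) * cCoef j * a j / lam ^ j)) *
            (x - t) ^ (2 * (2 * j - 1)) + 2 * ε ^ 2) := by
          gcongr with t x
          exact force_sq_le ha hlam hβ.bound_one _
      _ ≤ _ := hp.lintegral_lintegral_polynomial_le hμ hlam (Icc 2 J) (fun j => 2 * j - 1) _ hw
          (by positivity)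
      _ ≤ _ := by
          apply ENNReal.ofReal_le_ofReal
          refine le_trans (le_of_eq ?_) hκ
          congr 1
          have hterm : ∀ j ∈ Icc 2 J, 2 * polyRate J a lam *
              ((2 * (j : ℝ) * a j) ^ 2 / (2 * (j : ℝ) * cCoef j * a j / lam ^ j)) *
              ((Nat.factorial (2 * (2 * j - 1)) : ℝ) / Nat.factorial (2 * j - 1) /
                lam ^ (2 * j - 1)) =
              lam * polyRate J a lam * (2 * (j : ℝ) * cCoef j * a j / lam ^ j) := by
            intro j hj
            have hj2 := (mem_Icc.1 hj).1
            have hc2 : (Nat.factorial (2 * (2 * j - 1)) : ℝ) / Nat.factorial (2 * j - 1) =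
                cCoef j ^ 2 / 2 := by
              rw [cCoef_sq]
              ring
            rw [hc2]
            rcases eq_or_ne (a j) 0 with h0 | h0
            · simp [h0]
            · have hj0 : (j : ℝ) ≠ 0 := by positivity
              have hc := (cCoef_pos j).ne'
              have hl := hlam.ne'
              have hpow : lam * lam ^ (2 * j - 1) = lam ^ j * lam ^ j := by
                rw [← pow_succ', ← pow_add]
                congr 1
                omega
              field_simp
              linear_combination (-polyRate J a lam) * hpow
          rw [sum_congr rfl hterm, ← mul_sum]
          change lam * polyRate J a lam * polyRate J a lam = _
          ring

end

/-! ### Tails of the invariant density and stability under distant perturbations. -/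

/-- The mass of the density `p` outside the interval `(-r, r)`. -/
noncomputable def tailMass (p : ℝ → ℝ) (r : ℝ) : ℝ :=
  ∫ x, {x : ℝ | r ≤ |x|}.indicator p x

theorem measurableSet_le_abs (r : ℝ) : MeasurableSet {x : ℝ | r ≤ |x|} :=
  measurableSet_le measurable_const measurable_id.abs

section

variable {J : ℕ} {a : ℕ → ℝ} {lam B ε : ℝ} {β π : ℝ → ℝ}

/-- Only boundedness of `β` enters: its four translates cost `4B` in the symmetrised increment,
hence `2B` in the exponent, and of the polynomial only the leading term is kept. -/
theorem IsInvariantDensity.le_mul_exp (hJ : 1 ≤ J) (ha : ∀ j ∈ Icc 1 J, 0 ≤ a j)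
    (hB : ∀ y, |β y| ≤ B) (h : IsInvariantDensity (potential J a β) π) {u x : ℝ} (hu : 0 ≤ u)
    (hux : u ≤ x) :
    π x ≤ π u * Real.exp (2 * B - a J * (x ^ (2 * J) - u ^ (2 * J))) := by
  have hinc : conv (potential J a β) π u + (a J * (x ^ (2 * J) - u ^ (2 * J)) - 2 * B) ≤
      conv (potential J a β) π x := by
    refine conv_add_le h.nonneg h.integrable h.integral_eq_one h.even h.conv_exists fun t => ?_
    have h1 := symm_sum_increment ha t hu hux
    have h2 : a J * (x ^ (2 * J) - u ^ (2 * J)) ≤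
        ∑ j ∈ Icc 1 J, a j * (x ^ (2 * j) - u ^ (2 * j)) :=
      single_le_sum (f := fun j => a j * (x ^ (2 * j) - u ^ (2 * j)))
        (fun j hj => mul_nonneg (ha j hj) (sub_nonneg.2 (pow_le_pow_left₀ hu hux _)))
        (mem_Icc.2 ⟨hJ, le_rfl⟩)
    have b1 := abs_le.1 (hB (u - t))
    have b2 := abs_le.1 (hB (u + t))
    have b3 := abs_le.1 (hB (x - t))
    have b4 := abs_le.1 (hB (x + t))
    unfold potential
    linarith
  rw [h.self_consistent x, h.self_consistent u, mul_assoc, ← Real.exp_add]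
  have hZ := integral_exp_pos h.exp_integrable
  gcongr
  linarith

/-- Super-Gaussian tails of the invariant density. -/
theorem IsInvariantDensity.tailMass_le (hJ : 1 ≤ J) (ha : ∀ j ∈ Icc 1 J, 0 ≤ a j)
    (ha_top : 0 < a J) (hB : ∀ y, |β y| ≤ B) (h : IsInvariantDensity (potential J a β) π)
    {r : ℝ} (hr : 1 ≤ r) :
    tailMass π r ≤ Real.exp (2 * B + a J) * (∫ x, Real.exp (-(a J / 2) * x ^ 2)) *
      Real.exp (-(a J / 2) * r ^ (2 * J)) := by
  have hpt : ∀ x, 1 ≤ x → π x ≤ Real.exp (2 * B + a J) * Real.exp (-a J * x ^ (2 * J)) := by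
    intro x hx
    -- Averaging over `u ∈ [0, 1]`, where `π` has mass at most one, avoids any pointwise bound on
    -- `π` near the origin.
    have hu : ∀ u ∈ Set.Icc (0 : ℝ) 1,
        π x * Real.exp (a J * x ^ (2 * J) - (2 * B + a J)) ≤ π u := by
      intro u hu
      have h1 := h.le_mul_exp hJ ha hB hu.1 (hu.2.trans hx)
      have h2 : u ^ (2 * J) ≤ 1 := pow_le_one₀ hu.1 hu.2
      have h3 : π x ≤ π u * Real.exp (2 * B + a J - a J * x ^ (2 * J)) := by
        refine h1.trans (mul_le_mul_of_nonneg_left (Real.exp_le_exp.2 ?_) (h.nonneg u))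
        nlinarith
      calc _ ≤ π u * Real.exp (2 * B + a J - a J * x ^ (2 * J)) *
            Real.exp (a J * x ^ (2 * J) - (2 * B + a J)) := by gcongr
        _ = π u := by
            rw [mul_assoc, ← Real.exp_add]
            simp
    have h4 := setIntegral_mono_on (integrableOn_const (by simp)) h.integrable.integrableOn
      measurableSet_Icc hu
    have h5 : ∫ u in Set.Icc (0 : ℝ) 1, π u ≤ 1 := by
      rw [← h.integral_eq_one]
      exact setIntegral_le_integral h.integrable (Eventually.of_forall h.nonneg)
    simp only [integral_const, MeasurableSet.univ, measureReal_restrict_apply, Set.univ_inter,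
      Real.volume_real_Icc, sub_zero, zero_le_one, sup_of_le_left, smul_eq_mul, one_mul] at h4
    have h6 := h4.trans h5
    calc π x = (π x * Real.exp (a J * x ^ (2 * J) - (2 * B + a J))) *
          (Real.exp (2 * B + a J) * Real.exp (-a J * x ^ (2 * J))) := by
          rw [mul_assoc, ← Real.exp_add, ← Real.exp_add, show a J * x ^ (2 * J) - (2 * B + a J) +
            (2 * B + a J + -a J * x ^ (2 * J)) = 0 by ring, Real.exp_zero, mul_one]
      _ ≤ 1 * (Real.exp (2 * B + a J) * Real.exp (-a J * x ^ (2 * J))) := by gcongr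
      _ = _ := one_mul _
  have hgauss : Integrable (fun x : ℝ => Real.exp (2 * B + a J) *
      Real.exp (-(a J / 2) * r ^ (2 * J)) * Real.exp (-(a J / 2) * x ^ 2)) volume :=
    (integrable_exp_neg_mul_sq (half_pos ha_top)).const_mul _
  have hle : ∀ x, {x : ℝ | r ≤ |x|}.indicator π x ≤ Real.exp (2 * B + a J) *
      Real.exp (-(a J / 2) * r ^ (2 * J)) * Real.exp (-(a J / 2) * x ^ 2) := by
    intro x
    by_cases hx : r ≤ |x|
    swap
    · rw [Set.indicator_of_notMem (show x ∉ {x : ℝ | r ≤ |x|} from hx)]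
      positivity
    rw [Set.indicator_of_mem (show x ∈ {x : ℝ | r ≤ |x|} from hx)]
    have hx1 : 1 ≤ |x| := hr.trans hx
    have h1 : π |x| = π x := by
      rcases abs_choice x with h' | h' <;> rw [h']
      exact h.even x
    rw [← h1, mul_assoc, ← Real.exp_add]
    refine (hpt |x| hx1).trans ?_
    gcongr
    -- One half of `a_J |x|^(2J)` yields the factor in `r`. The other half dominates `a_J x²/2`,
    -- since `|x| ≥ 1`, and keeps the bound integrable.
    have h2 : r ^ (2 * J) ≤ |x| ^ (2 * J) := by gcongr
    have h3 : x ^ 2 ≤ |x| ^ (2 * J) := by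
      rw [← sq_abs]
      exact pow_le_pow_right₀ hx1 (by omega)
    nlinarith
  calc tailMass π r ≤ _ :=
        integral_mono (h.integrable.indicator (measurableSet_le_abs r)) hgauss hle
    _ = _ := by
        rw [integral_const_mul]
        ring

end

theorem tailMass_nonneg {p : ℝ → ℝ} (hp : ∀ x, 0 ≤ p x) (r : ℝ) : 0 ≤ tailMass p r :=
  integral_nonneg fun x => Set.indicator_nonneg (fun x _ => hp x) x

theorem abs_conv_le {μ η : ℝ → ℝ} {b : ℝ} (hμ0 : ∀ x, 0 ≤ μ x) (hμ : Integrable μ volume)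
    (hμ1 : ∫ x, μ x = 1) (hη : ∀ y, |η y| ≤ b) (x : ℝ) : |conv η μ x| ≤ b := by
  refine abs_integral_le_integral_abs.trans ?_
  have h : ∫ t, μ t * b = b := by rw [integral_mul_const, hμ1, one_mul]
  rw [← h]
  refine integral_mono_of_nonneg (Eventually.of_forall fun t => abs_nonneg _)
    (hμ.mul_const b) (Eventually.of_forall fun t => ?_)
  simp only [ContinuousLinearMap.mul_apply', abs_mul, abs_of_nonneg (hμ0 t)]
  exact mul_le_mul_of_nonneg_left (hη _) (hμ0 t)

/-- If `|x| ≤ ρ`, then `η(x - t) ≠ 0` requires `|x - t| > 2ρ`, hence `|t| > ρ`. -/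
theorem abs_conv_le_tailMass {μ η : ℝ → ℝ} {b ρ : ℝ} (hμ0 : ∀ x, 0 ≤ μ x)
    (hμ : Integrable μ volume) (hη : ∀ y, |η y| ≤ b) (hsupp : ∀ y, |y| ≤ 2 * ρ → η y = 0)
    {x : ℝ} (hx : |x| ≤ ρ) : |conv η μ x| ≤ b * tailMass μ ρ := by
  refine abs_integral_le_integral_abs.trans ?_
  unfold tailMass
  rw [← integral_const_mul]
  refine integral_mono_of_nonneg (Eventually.of_forall fun t => abs_nonneg _)
    ((hμ.indicator (measurableSet_le_abs ρ)).const_mul b) (Eventually.of_forall fun t => ?_)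
  simp only [ContinuousLinearMap.mul_apply', abs_mul, abs_of_nonneg (hμ0 t)]
  by_cases ht : ρ ≤ |t|
  · rw [Set.indicator_of_mem (show t ∈ {x : ℝ | ρ ≤ |x|} from ht), mul_comm b]
    exact mul_le_mul_of_nonneg_left (hη _) (hμ0 t)
  · have h0 : η (x - t) = 0 := by
      refine hsupp _ ((abs_sub _ _).trans ?_)
      linarith
    rw [h0, Set.indicator_of_notMem (show t ∉ {x : ℝ | ρ ≤ |x|} from ht)]
    simp

/-- Stability of the invariant density under a bounded perturbation supported far away. -/
theorem hell_le_tailMass {lam B₀ K₀ B₁ K₁ κ a b ρ G : ℝ} {n : ℕ} {φ₀ φ₁ g π₀ π₁ : ℝ → ℝ}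
    (hφ₀ : Confining lam B₀ K₀ n φ₀) (hφ₁ : Confining lam B₁ K₁ n φ₁) (hn : 1 ≤ n)
    (hlam : 0 < lam) (hc : Contractive lam κ a φ₁ g) (hκ : κ < 1)
    (hb : ∀ y, |φ₁ y - φ₀ y| ≤ b) (hρ : 0 ≤ ρ) (hsupp : ∀ y, |y| ≤ 2 * ρ → φ₁ y - φ₀ y = 0)
    (h₀ : IsInvariantDensity φ₀ π₀) (h₁ : IsInvariantDensity φ₁ π₁)
    (hG₀ : tailMass π₀ ρ ≤ G) (hG₁ : tailMass π₁ ρ ≤ G) :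
    hell π₀ π₁ ≤ 12 * b ^ 2 * G / (1 - κ) ^ 2 := by
  have d0 := h₀.gaussDecay hφ₀
  have d1 := h₁.gaussDecay hφ₁
  have hb0 : 0 ≤ b := (abs_nonneg _).trans (hb 0)
  have hG : 0 ≤ G := (tailMass_nonneg d0.nonneg ρ).trans hG₀
  set η : ℝ → ℝ := fun y => φ₁ y - φ₀ y with hη
  set E : ℝ → ℝ := fun x => conv η π₀ x - conv η π₀ 0 with hE
  set A : ℝ → ℝ := fun x => (conv φ₁ π₁ x - conv φ₁ π₁ 0) - (conv φ₁ π₀ x - conv φ₁ π₀ 0) with hA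
  have hconv : ∀ x, conv η π₀ x = conv φ₁ π₀ x - conv φ₀ π₀ x := by
    intro x
    simp only [conv_apply, hη, mul_sub]
    exact integral_sub (hφ₁.integrable_conv hlam d0 x) (hφ₀.integrable_conv hlam d0 x)
  have hηc : Continuous η := hφ₁.continuous.sub hφ₀.continuous
  have hEm : AEStronglyMeasurable E volume :=
    (aestronglyMeasurable_conv hηc d0.integrable.1).sub aestronglyMeasurable_const
  have hfar : ∀ x, |conv η π₀ x| ≤ b := abs_conv_le d0.nonneg d0.integrable d0.integral_eq_one hb
  have hnear : ∀ x, |x| ≤ ρ → |conv η π₀ x| ≤ b * G := fun x hx =>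
    (abs_conv_le_tailMass d0.nonneg d0.integrable hb hsupp hx).trans
      (mul_le_mul_of_nonneg_left hG₀ hb0)
  -- Within `ρ` one factor `|E|` is bounded by `2b` and the other by `2bG`; farther out both are
  -- bounded by `2b`. The result is linear in `G` without assuming `G ≤ 1`.
  have hE2 : ∀ x, E x ^ 2 ≤ 4 * b ^ 2 * (G + {x : ℝ | ρ ≤ |x|}.indicator 1 x) := by
    intro x
    have hEb : |E x| ≤ 2 * b := by
      refine (abs_sub _ _).trans ?_
      linarith [hfar x, hfar 0]
    rw [← sq_abs]
    by_cases hx : ρ ≤ |x|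
    · rw [Set.indicator_of_mem (show x ∈ {x : ℝ | ρ ≤ |x|} from hx), Pi.one_apply]
      nlinarith [abs_nonneg (E x), mul_nonneg (sq_nonneg b) hG]
    · have hEn : |E x| ≤ 2 * (b * G) := by
        refine (abs_sub _ _).trans ?_
        linarith [hnear x (le_of_not_ge hx), hnear 0 (by simpa using hρ)]
      rw [Set.indicator_of_notMem (show x ∉ {x : ℝ | ρ ≤ |x|} from hx), add_zero, sq]
      calc |E x| * |E x| ≤ 2 * b * (2 * (b * G)) :=
            mul_le_mul hEb hEn (abs_nonneg _) (by positivity)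
        _ = _ := by ring
  have hEi : ∀ p, GaussDecay lam p → tailMass p ρ ≤ G →
      Integrable (fun x => p x * E x ^ 2) volume ∧ ∫ x, p x * E x ^ 2 ≤ 8 * b ^ 2 * G := by
    intro p hp hGp
    have hi : Integrable (fun x => 4 * b ^ 2 * (p x * G + {x : ℝ | ρ ≤ |x|}.indicator p x))
        volume := ((hp.integrable.mul_const G).add
      (hp.integrable.indicator (measurableSet_le_abs ρ))).const_mul _
    have hle : ∀ x, p x * E x ^ 2 ≤
        4 * b ^ 2 * (p x * G + {x : ℝ | ρ ≤ |x|}.indicator p x) := by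
      intro x
      have heq : {x : ℝ | ρ ≤ |x|}.indicator p x = p x * {x : ℝ | ρ ≤ |x|}.indicator 1 x := by
        by_cases hx : x ∈ {x : ℝ | ρ ≤ |x|} <;> simp [Set.indicator, hx]
      rw [heq]
      refine (mul_le_mul_of_nonneg_left (hE2 x) (hp.nonneg x)).trans (le_of_eq ?_)
      ring
    have hint : Integrable (fun x => p x * E x ^ 2) volume := by
      refine hi.mono' (hp.integrable.1.mul (hEm.pow 2)) (Eventually.of_forall fun x => ?_)
      rw [Real.norm_eq_abs, abs_of_nonneg (mul_nonneg (hp.nonneg x) (sq_nonneg _))]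
      exact hle x
    refine ⟨hint, (integral_mono hint hi hle).trans ?_⟩
    rw [integral_const_mul, integral_add (hp.integrable.mul_const G)
      (hp.integrable.indicator (measurableSet_le_abs ρ)), integral_mul_const, hp.integral_eq_one]
    unfold tailMass at hGp
    nlinarith [sq_nonneg b]
  obtain ⟨iA0, eA0⟩ := hφ₁.integral_sq_conv_sub_le hn hlam hc d0 d1 d0
  obtain ⟨iA1, eA1⟩ := hφ₁.integral_sq_conv_sub_le hn hlam hc d0 d1 d1
  obtain ⟨iE0, eE0⟩ := hEi π₀ d0 hG₀
  obtain ⟨iE1, eE1⟩ := hEi π₁ d1 hG₁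
  obtain ⟨c, hlog⟩ := log_gibbs_sub h₀.exp_integrable h₁.exp_integrable
  rw [← h₀.eq_gibbs, ← h₁.eq_gibbs] at hlog
  have hδ : 0 < 1 - κ := by linarith
  -- With this Young parameter `(1 + θ)κ ≤ 1 - θ`, so the contraction term can be absorbed and a
  -- factor `θ` remains on the left.
  set θ := (1 - κ) / 2 with hθ
  have hθ0 : 0 < θ := by positivity
  have hW : ∀ x, Real.log (π₀ x) - Real.log (π₁ x) = (A x + E x) + c := fun x => by
    rw [hlog, hA, hE]
    simp only [hconv]
    ring
  have hW2 : ∀ p, GaussDecay lam p → ∀ x, p x * (A x + E x) ^ 2 ≤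
      (1 + θ) * (p x * A x ^ 2) + (1 + 1 / θ) * (p x * E x ^ 2) := by
    intro p hp x
    have h1 : (A x + E x) ^ 2 ≤ (1 + θ) * A x ^ 2 + (1 + 1 / θ) * E x ^ 2 := by
      have h2 : 0 ≤ (θ * A x - E x) ^ 2 / θ := by positivity
      have h3 : (θ * A x - E x) ^ 2 / θ = θ * A x ^ 2 - 2 * A x * E x + 1 / θ * E x ^ 2 := by
        field_simp
        ring
      linarith
    refine (mul_le_mul_of_nonneg_left h1 (hp.nonneg x)).trans (le_of_eq ?_)
    ring
  have hAm : AEStronglyMeasurable A volume :=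
    ((aestronglyMeasurable_conv hφ₁.continuous d1.integrable.1).sub
      aestronglyMeasurable_const).sub ((aestronglyMeasurable_conv hφ₁.continuous
      d0.integrable.1).sub aestronglyMeasurable_const)
  have hWi : ∀ p, GaussDecay lam p → Integrable (fun x => p x * A x ^ 2) volume →
      Integrable (fun x => p x * E x ^ 2) volume →
      Integrable (fun x => p x * (A x + E x) ^ 2) volume ∧ ∫ x, p x * (A x + E x) ^ 2 ≤
        (1 + θ) * (∫ x, p x * A x ^ 2) + (1 + 1 / θ) * ∫ x, p x * E x ^ 2 := by
    intro p hp iA iE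
    have hi : Integrable (fun x => (1 + θ) * (p x * A x ^ 2) + (1 + 1 / θ) * (p x * E x ^ 2))
      volume := (iA.const_mul _).add (iE.const_mul _)
    have hint : Integrable (fun x => p x * (A x + E x) ^ 2) volume := by
      refine hi.mono' (hp.integrable.1.mul ((hAm.add hEm).pow 2))
        (Eventually.of_forall fun x => ?_)
      rw [Real.norm_eq_abs, abs_of_nonneg (mul_nonneg (hp.nonneg x) (sq_nonneg _))]
      exact hW2 p hp x
    refine ⟨hint, (integral_mono hint hi (hW2 p hp)).trans (le_of_eq ?_)⟩
    rw [integral_add (iA.const_mul _) (iE.const_mul _), integral_const_mul, integral_const_mul]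
  obtain ⟨i0, e0⟩ := hWi π₀ d0 iA0 iE0
  obtain ⟨i1, e1⟩ := hWi π₁ d1 iA1 iE1
  have h := hell_le_of_log_sub h₀.pos h₁.pos d0.integrable d1.integrable
    (d0.integral_eq_one.trans d1.integral_eq_one.symm) hW
    (by simp only [add_mul]; exact i0.add i1)
  simp_rw [add_mul] at h
  rw [integral_add i0 i1] at h
  have hH := hell_nonneg π₀ π₁
  have hκ0 := hc.nonneg
  have k1 : ∫ x, π₀ x * (A x + E x) ^ 2 ≤
      (1 + θ) * (4 * κ * hell π₀ π₁) + (1 + 1 / θ) * (8 * b ^ 2 * G) := by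
    refine e0.trans ?_
    gcongr
  have k2 : ∫ x, π₁ x * (A x + E x) ^ 2 ≤
      (1 + θ) * (4 * κ * hell π₀ π₁) + (1 + 1 / θ) * (8 * b ^ 2 * G) := by
    refine e1.trans ?_
    gcongr
  have k3 : hell π₀ π₁ ≤ (1 + θ) * κ * hell π₀ π₁ + (1 + 1 / θ) * (2 * b ^ 2 * G) := by
    linarith
  have k4 : (1 + θ) * κ ≤ 1 - θ := by
    rw [hθ]
    nlinarith
  have k5 : θ * hell π₀ π₁ ≤ (1 + 1 / θ) * (2 * b ^ 2 * G) := by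
    nlinarith
  have k6 : 1 + 1 / θ ≤ 3 / (2 * θ) := by
    have hθ1 : θ ≤ 1 / 2 := by
      rw [hθ]
      linarith
    rw [one_add_div hθ0.ne', div_le_div_iff₀ hθ0 (by positivity)]
    nlinarith
  have k7 : θ * hell π₀ π₁ ≤ 3 / (2 * θ) * (2 * b ^ 2 * G) :=
    k5.trans (mul_le_mul_of_nonneg_right k6 (by positivity))
  rw [show 1 - κ = 2 * θ by rw [hθ]; ring, le_div_iff₀ (by positivity)]
  have k8 : 3 / (2 * θ) * (2 * b ^ 2 * G) * θ = 3 * b ^ 2 * G := by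
    field_simp
  have k9 := mul_le_mul_of_nonneg_right k7 hθ0.le
  rw [k8] at k9
  linarith

/-! ### Le Cam's two-point argument. -/

theorem isFiniteMeasure_law {p : ℝ → ℝ} (hp : Integrable p volume) : IsFiniteMeasure (law p) :=
  isFiniteMeasure_withDensity_ofReal hp.2

theorem law_mono {p q : ℝ → ℝ} (h : ∀ x, p x ≤ q x) : law p ≤ law q :=
  withDensity_mono (Eventually.of_forall fun x => ENNReal.ofReal_le_ofReal (h x))

theorem law_univ {p : ℝ → ℝ} (hp0 : ∀ x, 0 ≤ p x) (hp : Integrable p volume) :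
    law p Set.univ = ENNReal.ofReal (∫ x, p x) := by
  rw [law, withDensity_apply _ MeasurableSet.univ, Measure.restrict_univ,
    ofReal_integral_eq_lintegral_ofReal hp (Eventually.of_forall hp0)]

/-- The comparison is made between outer measures: the product outer measure for `ν` is the largest
one dominated by the `ν`-products on boxes. No finiteness is needed. -/
theorem measure_pi_mono {ι : Type*} [Fintype ι] {α : ι → Type*} [∀ i, MeasurableSpace (α i)]
    {μ ν : ∀ i, Measure (α i)} (h : ∀ i, μ i ≤ ν i) : Measure.pi μ ≤ Measure.pi ν := by
  refine Measure.le_iff.2 fun s hs => ?_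
  rw [Measure.pi, Measure.pi, toMeasure_apply _ _ hs, toMeasure_apply _ _ hs]
  have : (OuterMeasure.pi fun i => (μ i).toOuterMeasure) ≤
      OuterMeasure.pi fun i => (ν i).toOuterMeasure := by
    rw [OuterMeasure.le_pi]
    intro t _
    refine (OuterMeasure.pi_pi_le _ t).trans ?_
    exact Finset.prod_le_prod' fun i _ => h i (t i)
  exact this s

/-- Le Cam's two-point bound for product measures, in terms of the Hellinger distance. -/
theorem quarter_le_law_pi {p q : ℝ → ℝ} (hp0 : ∀ x, 0 ≤ p x) (hq0 : ∀ x, 0 ≤ q x)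
    (hp : Integrable p volume) (hq : Integrable q volume) (hp1 : ∫ x, p x = 1)
    (hq1 : ∫ x, q x = 1) {N : ℕ} (hN : 1 ≤ N) (hH : (N : ℝ) ^ 2 * hell p q ≤ 1 / 4)
    {s t : Set (Fin N → ℝ)} (hst : s ∪ t = Set.univ) :
    ENNReal.ofReal (1 / 4) ≤ Measure.pi (fun _ : Fin N => law p) s ∨
      ENNReal.ofReal (1 / 4) ≤ Measure.pi (fun _ : Fin N => law q) t := by
  -- The product of the measures with density `min p q` lies below both product laws, and its mass
  -- is at least `1 - N √(hell p q) ≥ 1/2` by Bernoulli's inequality. Covering the space by `s` and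
  -- `t` forces one of them to carry a quarter; subadditivity requires no measurability of `s` or
  -- `t`.
  set m : ℝ → ℝ := fun x => min (p x) (q x) with hm
  have hm0 : ∀ x, 0 ≤ m x := fun x => le_min (hp0 x) (hq0 x)
  have hmi : Integrable m volume := hp.inf hq
  have := isFiniteMeasure_law hmi
  have hsq : (N : ℝ) * √(hell p q) ≤ 1 / 2 := by
    refine abs_le_of_sq_le_sq' ?_ (by norm_num) |>.2
    rw [mul_pow, Real.sq_sqrt (hell_nonneg p q)]
    linarith
  have hN1 : (1 : ℝ) ≤ N := by exact_mod_cast hN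
  have hs0 := Real.sqrt_nonneg (hell p q)
  have hs1 : √(hell p q) ≤ 1 / 2 := by nlinarith
  have hmass : 1 / 2 ≤ (∫ x, m x) ^ N := by
    have h1 := one_sub_sqrt_hell_le_integral_min hp0 hq0 hp hq hp1 hq1
    have h2 := one_add_mul_le_pow (a := -√(hell p q)) (by linarith) N
    calc (1 : ℝ) / 2 ≤ 1 + N * (-√(hell p q)) := by linarith
      _ ≤ (1 + -√(hell p q)) ^ N := h2
      _ ≤ _ := pow_le_pow_left₀ (by linarith) (by linarith) N
  have huniv : ENNReal.ofReal (1 / 2) ≤ Measure.pi (fun _ : Fin N => law m) Set.univ := by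
    rw [Measure.pi_univ, Finset.prod_const, Finset.card_univ, Fintype.card_fin, law_univ hm0 hmi,
      ← ENNReal.ofReal_pow (integral_nonneg hm0)]
    exact ENNReal.ofReal_le_ofReal hmass
  have hle : Measure.pi (fun _ : Fin N => law m) Set.univ ≤
      Measure.pi (fun _ : Fin N => law p) s + Measure.pi (fun _ : Fin N => law q) t := by
    rw [← hst]
    refine (measure_union_le s t).trans (add_le_add ?_ ?_)
    · exact measure_pi_mono (fun _ => law_mono fun x => min_le_left _ _) s
    · exact measure_pi_mono (fun _ => law_mono fun x => min_le_right _ _) t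
  by_contra! hcon
  have h := (huniv.trans hle).trans_lt (ENNReal.add_lt_add hcon.1 hcon.2)
  rw [← ENNReal.ofReal_add (by norm_num) (by norm_num)] at h
  norm_num at h

/-- By the triangle inequality, no estimate is within squared distance `r` of both targets. -/
theorem union_eq_univ_of_separated {Ω : Type*} {f₀ f₁ : ℝ → ℝ}
    (h₀ : AEStronglyMeasurable f₀ volume) (h₁ : AEStronglyMeasurable f₁ volume)
    {est : Ω → ℝ → ℝ} (hest : ∀ Y, AEStronglyMeasurable (est Y) volume) {r : ℝ≥0∞}
    (hr : 4 * r < eLpNorm (fun x => f₁ x - f₀ x) 2 volume ^ 2) :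
    {Y | r < eLpNorm (fun x => est Y x - f₀ x) 2 volume ^ 2} ∪
      {Y | r < eLpNorm (fun x => est Y x - f₁ x) 2 volume ^ 2} = Set.univ := by
  refine Set.eq_univ_of_forall fun Y => ?_
  by_contra hY
  simp only [Set.mem_union, Set.mem_ofPred_eq, not_or, not_lt] at hY
  refine absurd hr (not_lt.2 ?_)
  have htri : eLpNorm (fun x => f₁ x - f₀ x) 2 volume ≤
      eLpNorm (fun x => est Y x - f₀ x) 2 volume + eLpNorm (fun x => est Y x - f₁ x) 2 volume := by
    have h := eLpNorm_sub_le ((hest Y).sub h₀) ((hest Y).sub h₁) (p := 2) (by norm_num)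
    refine le_trans (le_of_eq ?_) h
    congr 1
    ext x
    simp
  set M := max (eLpNorm (fun x => est Y x - f₀ x) 2 volume)
    (eLpNorm (fun x => est Y x - f₁ x) 2 volume) with hM
  have hMr : M ^ 2 ≤ r := by
    rcases max_choice (eLpNorm (fun x => est Y x - f₀ x) 2 volume)
      (eLpNorm (fun x => est Y x - f₁ x) 2 volume) with h | h
    · rw [hM, h]
      exact hY.1
    · rw [hM, h]
      exact hY.2
  calc _ ≤ (M + M) ^ 2 := by
        gcongr
        exact htri.trans (add_le_add (le_max_left _ _) (le_max_right _ _))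
    _ = 4 * M ^ 2 := by ring
    _ ≤ 4 * r := by gcongr

/-- The radius at which the density is too small to be noticed by `N` observations. -/
theorem exists_radius_const (J : ℕ) {γ D : ℝ} (hγ : 0 < γ) (hD : 0 ≤ D) :
    ∃ A : ℝ, 0 < A ∧ ∀ N : ℕ, 2 ≤ N → (4 : ℝ) ^ (2 * J) ≤ A * Real.log N ∧
      (N : ℝ) ^ 2 * (D * Real.exp (-γ * (A * Real.log N))) ≤ 1 / 4 := by
  have hl2 : 0 < Real.log 2 := Real.log_pos (by norm_num)
  -- This `k` satisfies `2^(-k) = 1/(4D + 1)`. Taking `γA ≥ 2 + k` leaves `N² N^(-γA) ≤ N^(-k) ≤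
  -- 2^(-k)` for `N ≥ 2`. The other entry of the maximum ensures `R ≥ 4`.
  set k : ℝ := Real.log (4 * D + 1) / Real.log 2 with hk
  have hk0 : 0 ≤ k := div_nonneg (Real.log_nonneg (by linarith)) hl2.le
  refine ⟨max ((4 : ℝ) ^ (2 * J) / Real.log 2) ((2 + k) / γ),
    lt_max_of_lt_left (by positivity), fun N hN => ?_⟩
  have hN2 : (2 : ℝ) ≤ N := by exact_mod_cast hN
  have hlN : Real.log 2 ≤ Real.log N := Real.log_le_log (by norm_num) hN2
  set A := max ((4 : ℝ) ^ (2 * J) / Real.log 2) ((2 + k) / γ) with hA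
  have hA1 : (4 : ℝ) ^ (2 * J) / Real.log 2 ≤ A := le_max_left _ _
  have hA2 : (2 + k) / γ ≤ A := le_max_right _ _
  rw [div_le_iff₀ hl2] at hA1
  rw [div_le_iff₀ hγ] at hA2
  have hA0 : 0 ≤ A := by
    have : 0 ≤ (2 + k) / γ := by positivity
    exact this.trans (le_max_right _ _)
  refine ⟨hA1.trans (mul_le_mul_of_nonneg_left hlN hA0), ?_⟩
  have hN0 : (0 : ℝ) < N := by linarith
  have hNsq : (N : ℝ) ^ 2 = Real.exp (2 * Real.log N) := by
    rw [two_mul, Real.exp_add, Real.exp_log hN0, sq]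
  have hexp : Real.exp (2 * Real.log N) * Real.exp (-γ * (A * Real.log N)) ≤ (4 * D + 1)⁻¹ := by
    rw [← Real.exp_add, ← Real.exp_log (by linarith : 0 < 4 * D + 1), ← Real.exp_neg]
    rw [Real.exp_le_exp]
    have h1 : Real.log (4 * D + 1) = k * Real.log 2 := by
      rw [hk]
      field_simp
    rw [h1]
    have h2 : k * Real.log 2 ≤ k * Real.log N := mul_le_mul_of_nonneg_left hlN hk0
    have h3 : (2 + k) * Real.log N ≤ A * γ * Real.log N :=
      mul_le_mul_of_nonneg_right hA2 (hl2.le.trans hlN)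
    linarith
  rw [hNsq]
  calc Real.exp (2 * Real.log N) * (D * Real.exp (-γ * (A * Real.log N)))
      = D * (Real.exp (2 * Real.log N) * Real.exp (-γ * (A * Real.log N))) := by ring
    _ ≤ D * (4 * D + 1)⁻¹ := mul_le_mul_of_nonneg_left hexp hD
    _ ≤ 1 / 4 := by
        rw [← div_eq_mul_inv, div_le_iff₀ (by linarith)]
        linarith

/-! ### The pair of bumps as an element of the class. -/

/-- A smooth even bump supported in `[-1, 1]`. -/
noncomputable def bump : ContDiffBump (0 : ℝ) := ⟨1 / 2, 1, by norm_num, by norm_num⟩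

/-- Two copies of the bump, of height `s` and centred at `R` and `-R`. -/
noncomputable def twoBumps (s R : ℝ) (y : ℝ) : ℝ := s * (bump (y - R) + bump (y + R))

theorem bump_eq_zero {y : ℝ} (hy : 1 ≤ |y|) : bump y = 0 :=
  bump.zero_of_le_dist (by rw [Real.dist_eq, sub_zero]; exact hy)

theorem differentiable_bump : Differentiable ℝ bump :=
  (bump.contDiff (n := 1)).differentiable (by norm_num)

theorem contDiff_deriv_bump : ContDiff ℝ 1 (deriv bump) :=
  (contDiff_succ_iff_deriv.1 (bump.contDiff (n := 1 + 1))).2.2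

theorem deriv_bump_eq_zero {y : ℝ} (hy : 1 < |y|) : deriv bump y = 0 := by
  have h : bump =ᶠ[nhds y] fun _ => 0 := by
    filter_upwards [(isOpen_lt continuous_const continuous_abs).mem_nhds hy] with z hz
    exact bump_eq_zero (le_of_lt hz)
  rw [h.deriv_eq, deriv_const]

theorem exists_bump_bound : ∃ M : ℝ, 0 < M ∧ (∀ y, |bump y| ≤ M) ∧ (∀ y, |deriv bump y| ≤ M) ∧
    ∀ y, |deriv (deriv bump) y| ≤ M := by
  have hc := bump.hasCompactSupport
  obtain ⟨M0, h0⟩ := hc.exists_bound_of_continuous bump.continuous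
  obtain ⟨M1, h1⟩ := hc.deriv.exists_bound_of_continuous contDiff_deriv_bump.continuous
  obtain ⟨M2, h2⟩ := hc.deriv.deriv.exists_bound_of_continuous
    (contDiff_deriv_bump.continuous_deriv le_rfl)
  exact ⟨max 1 (max M0 (max M1 M2)), lt_max_of_lt_left one_pos,
    fun y => (h0 y).trans (by simp), fun y => (h1 y).trans (by simp),
    fun y => (h2 y).trans (by simp)⟩

theorem contDiff_twoBumps (s R : ℝ) : ContDiff ℝ 2 (twoBumps s R) :=
  contDiff_const.mul ((bump.contDiff.comp (contDiff_id.sub contDiff_const)).add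
    (bump.contDiff.comp (contDiff_id.add contDiff_const)))

theorem even_twoBumps (s R : ℝ) : Function.Even (twoBumps s R) := by
  intro y
  unfold twoBumps
  rw [show -y - R = -(y + R) by ring, show -y + R = -(y - R) by ring, bump.neg, bump.neg,
    add_comm]

theorem deriv_twoBumps (s R : ℝ) :
    deriv (twoBumps s R) = fun y => s * (deriv bump (y - R) + deriv bump (y + R)) := by
  ext y
  have h1 := (differentiable_bump (y - R)).hasDerivAt.comp y ((hasDerivAt_id y).sub_const R)
  have h2 := (differentiable_bump (y + R)).hasDerivAt.comp y ((hasDerivAt_id y).add_const R)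
  have h := ((h1.add h2).const_mul s).deriv
  simp only [mul_one] at h
  exact h

theorem iteratedDeriv_two_twoBumps (s R : ℝ) : iteratedDeriv 2 (twoBumps s R) =
    fun y => s * (deriv (deriv bump) (y - R) + deriv (deriv bump) (y + R)) := by
  ext y
  have hd : Differentiable ℝ (deriv bump) := contDiff_deriv_bump.differentiable (by norm_num)
  have h1 := (hd (y - R)).hasDerivAt.comp y ((hasDerivAt_id y).sub_const R)
  have h2 := (hd (y + R)).hasDerivAt.comp y ((hasDerivAt_id y).add_const R)
  have h := ((h1.add h2).const_mul s).deriv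
  simp only [mul_one] at h
  rw [iteratedDeriv_succ, iteratedDeriv_one, deriv_twoBumps]
  exact h

theorem abs_mul_add_le {s u v M : ℝ} (hs : 0 ≤ s) (hu : |u| ≤ M) (hv : |v| ≤ M) :
    |s * (u + v)| ≤ 2 * s * M := by
  rw [abs_mul, abs_of_nonneg hs]
  calc s * |u + v| ≤ s * (M + M) := by
        gcongr
        exact (abs_add_le u v).trans (add_le_add hu hv)
    _ = _ := by ring

theorem twoBumps_eq_zero {s R y : ℝ} (hy : |y| ≤ R - 1) : twoBumps s R y = 0 := by
  rw [abs_le] at hy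
  unfold twoBumps
  rw [bump_eq_zero (y := y - R) (by rw [abs_of_nonpos] <;> linarith),
    bump_eq_zero (y := y + R) (by rw [abs_of_nonneg] <;> linarith)]
  simp

theorem perturbation_twoBumps {s R M c : ℝ} (hs : 0 ≤ s) (h0 : ∀ y, |bump y| ≤ M)
    (h1 : ∀ y, |deriv bump y| ≤ M) (h2 : ∀ y, |deriv (deriv bump) y| ≤ M) {B ε : ℝ}
    (hB : 2 * s * M ≤ B) (hε : 2 * s * M ≤ ε) (hc : 2 * s * M ≤ c) :
    Perturbation B ε c (twoBumps s R) where
  contDiff := contDiff_twoBumps s R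
  even := even_twoBumps s R
  bound_zero := fun y => (abs_mul_add_le hs (h0 _) (h0 _)).trans hB
  bound_one := fun y => by
    rw [deriv_twoBumps]
    exact (abs_mul_add_le hs (h1 _) (h1 _)).trans hε
  lower_two := fun y => by
    rw [iteratedDeriv_two_twoBumps]
    exact (abs_le.1 ((abs_mul_add_le hs (h2 _) (h2 _)).trans hc)).1

/-- The tail of the derivative is bounded uniformly, not only asymptotically. -/
theorem rpow_mul_lintegral_deriv_twoBumps_le {s₀ R M p C : ℝ} (hs : 0 ≤ s₀) (hR : 1 ≤ R)
    (hp : 0 < p) (h1 : ∀ y, |deriv bump y| ≤ M)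
    (hC : (2 : ℝ) ^ (2 * p) * (8 * (s₀ * M) ^ 2) ≤ C) {y : ℝ} (hy : 0 ≤ y) :
    ENNReal.ofReal (y ^ (2 * p)) * ∫⁻ u in Set.Ioi y,
      ENNReal.ofReal (|deriv (twoBumps (s₀ * R ^ (-p)) R) u| ^ 2) ≤ ENNReal.ofReal C := by
  have hR0 : 0 < R := by linarith
  have hRp : 0 < R ^ (-p) := Real.rpow_pos_of_pos hR0 _
  set s := s₀ * R ^ (-p) with hsdef
  have hs' : 0 ≤ s := by positivity
  have hzero : ∀ u, 0 < u → (u < R - 1 ∨ R + 1 < u) → deriv (twoBumps s R) u = 0 := by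
    intro u hu h
    have e1 : deriv bump (u - R) = 0 := deriv_bump_eq_zero (by
      rw [lt_abs]
      rcases h with h | h
      · right; linarith
      · left; linarith)
    have e2 : deriv bump (u + R) = 0 := deriv_bump_eq_zero (by
      rw [lt_abs]
      left; linarith)
    simp [deriv_twoBumps, e1, e2]
  rcases lt_or_ge (R + 1) y with hyR | hyR
  · have : ∫⁻ u in Set.Ioi y, ENNReal.ofReal (|deriv (twoBumps s R) u| ^ 2) = 0 := by
      rw [setLIntegral_congr_fun (g := fun _ => 0) measurableSet_Ioi fun u hu => ?_]
      · simp
      · have hu' : y < u := hu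
        simp [hzero u (by linarith) (Or.inr (by linarith))]
    rw [this, mul_zero]
    exact zero_le
  · have hint : ∫⁻ u in Set.Ioi y, ENNReal.ofReal (|deriv (twoBumps s R) u| ^ 2) ≤
        ENNReal.ofReal ((2 * s * M) ^ 2 * 2) := by
      calc _ ≤ ∫⁻ u in Set.Ioi y, (Set.Icc (R - 1) (R + 1)).indicator
            (fun _ => ENNReal.ofReal ((2 * s * M) ^ 2)) u := by
            refine setLIntegral_mono' measurableSet_Ioi fun u hu => ?_
            have hu' : y < u := hu
            by_cases hmem : u ∈ Set.Icc (R - 1) (R + 1)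
            · rw [Set.indicator_of_mem hmem]
              apply ENNReal.ofReal_le_ofReal
              refine pow_le_pow_left₀ (abs_nonneg _) ?_ 2
              rw [deriv_twoBumps]
              exact abs_mul_add_le hs' (h1 _) (h1 _)
            · rw [Set.indicator_of_notMem hmem, hzero u (by linarith) (by
                rw [Set.mem_Icc, not_and_or, not_le, not_le] at hmem
                exact hmem)]
              simp
        _ ≤ ∫⁻ u, (Set.Icc (R - 1) (R + 1)).indicator
            (fun _ => ENNReal.ofReal ((2 * s * M) ^ 2)) u := setLIntegral_le_lintegral _ _
        _ = _ := by
            rw [lintegral_indicator_const measurableSet_Icc, Real.volume_Icc,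
              ← ENNReal.ofReal_mul (by positivity)]
            congr 2
            ring
    -- Here `y ≤ R + 1 ≤ 2R`, and the derivative on the positive axis lives on an interval of length
    -- `2`. The powers of `R` cancel against the squared height.
    calc _ ≤ ENNReal.ofReal ((2 * R) ^ (2 * p)) * ENNReal.ofReal ((2 * s * M) ^ 2 * 2) := by
          gcongr
          linarith
      _ ≤ ENNReal.ofReal C := by
          rw [← ENNReal.ofReal_mul (by positivity)]
          apply ENNReal.ofReal_le_ofReal
          refine le_trans (le_of_eq ?_) hC
          have hcancel : R ^ (2 * p) * (R ^ (-p)) ^ 2 = 1 := by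
            rw [← Real.rpow_natCast, ← Real.rpow_mul hR0.le, ← Real.rpow_add hR0]
            norm_num
            ring_nf
            exact Real.rpow_zero R
          rw [Real.mul_rpow (by norm_num) hR0.le, hsdef]
          linear_combination (2 : ℝ) ^ (2 * p) * (8 * (s₀ * M) ^ 2) * hcancel

/-- The squared `L²` norm of the derivative of the bump. -/
theorem integral_sq_deriv_bump_pos : 0 < ∫ y, deriv bump y ^ 2 := by
  have hne : ∃ y, deriv bump y ≠ 0 := by
    by_contra! h
    have hconst := is_const_of_deriv_eq_zero differentiable_bump h 0 1
    rw [bump_eq_zero (y := 1) (by simp), bump.one_of_mem_closedBall (by simp [bump.rIn_pos.le])]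
      at hconst
    norm_num at hconst
  obtain ⟨y, hy⟩ := hne
  have hcont : Continuous fun y => deriv bump y ^ 2 := contDiff_deriv_bump.continuous.pow 2
  have hcs : HasCompactSupport fun y => deriv bump y ^ 2 := by
    simp only [sq]
    exact bump.hasCompactSupport.deriv.mul_left (f := deriv bump)
  exact hcont.integral_pos_of_hasCompactSupport_nonneg_nonzero hcs (fun y => sq_nonneg _)
    (x := y) (pow_ne_zero 2 hy)

/-- The derivatives of the two bumps have disjoint supports, so the cross term vanishes; the bump at
`-R` is simply discarded. -/
theorem ofReal_le_eLpNorm_deriv_twoBumps {s R : ℝ} (hR : 1 < R) :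
    ENNReal.ofReal (s ^ 2 * ∫ y, deriv bump y ^ 2) ≤
      eLpNorm (deriv (twoBumps s R)) 2 volume ^ 2 := by
  -- A non-integrable function would have integral `0` by convention, contradicting positivity.
  have hi : Integrable (fun y => deriv bump y ^ 2) volume := by
    by_contra h
    have := integral_sq_deriv_bump_pos
    rw [integral_undef h] at this
    exact this.false
  have h2 : eLpNorm (deriv (twoBumps s R)) 2 volume ^ 2 =
      ∫⁻ y, ‖deriv (twoBumps s R) y‖ₑ ^ 2 := by
    have := eLpNorm_nnreal_pow_eq_lintegral (f := deriv (twoBumps s R)) (p := 2)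
      (μ := volume) (by norm_num)
    simpa using this
  rw [h2, ENNReal.ofReal_mul (sq_nonneg s), ofReal_integral_eq_lintegral_ofReal hi
    (Eventually.of_forall fun y => sq_nonneg _),
    ← lintegral_sub_right_eq_self (fun y => ENNReal.ofReal (deriv bump y ^ 2)) R,
    ← lintegral_const_mul' _ _ ENNReal.ofReal_ne_top]
  refine lintegral_mono fun y => ?_
  rw [← ENNReal.ofReal_mul (sq_nonneg s), Real.enorm_eq_ofReal_abs,
    ← ENNReal.ofReal_pow (abs_nonneg _), sq_abs, deriv_twoBumps]
  apply ENNReal.ofReal_le_ofReal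
  have hdisj : deriv bump (y - R) * deriv bump (y + R) = 0 := by
    rcases le_or_gt y 0 with h | h
    · rw [deriv_bump_eq_zero (y := y - R), zero_mul]
      rw [lt_abs]
      right; linarith
    · rw [deriv_bump_eq_zero (y := y + R), mul_zero]
      rw [lt_abs]
      left; linarith
  have : (s * (deriv bump (y - R) + deriv bump (y + R))) ^ 2 =
      s ^ 2 * deriv bump (y - R) ^ 2 + s ^ 2 * deriv bump (y + R) ^ 2 := by
    linear_combination 2 * s ^ 2 * hdisj
  rw [this]
  exact le_add_of_nonneg_right (by positivity)

theorem inClass_of_perturbation {J : ℕ} {a : ℕ → ℝ} {p C C₀ lam ε : ℝ} {β : ℝ → ℝ}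
    (hβ : Perturbation C₀ ε (C₂ a lam) β) (hε : ε ≤ C₁ J a lam)
    (hb : ∃ B, ∀ y, |iteratedDeriv 2 β y| ≤ B)
    (htail : ∀ y : ℝ, 0 ≤ y → ENNReal.ofReal (y ^ (2 * p)) *
      ∫⁻ u in Set.Ioi y, ENNReal.ofReal (|deriv β u| ^ 2) ≤ ENNReal.ofReal C) :
    InClass J a p C C₀ lam β where
  contDiff := hβ.contDiff
  even := hβ.even
  bound_zero := hβ.bound_zero
  bound_one := fun y => (hβ.bound_one y).trans hε
  bounded_two := hb
  lower_two := hβ.lower_two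
  tail := limsup_le_of_le (by isBoundedDefault) ((eventually_ge_atTop 0).mono htail)

theorem perturbation_zero {B ε c : ℝ} (hB : 0 ≤ B) (hε : 0 ≤ ε) (hc : 0 ≤ c) :
    Perturbation B ε c fun _ => 0 where
  contDiff := contDiff_const
  even := fun _ => rfl
  bound_zero := fun _ => by simpa using hB
  bound_one := fun _ => by simpa using hε
  lower_two := fun _ => by simpa [iteratedDeriv_succ] using hc

/-- Since `C₁ > 0` means `polyRate < 1`, the gap `1 - polyRate²` is divided in two: half of it pays
for the perturbation `2ε²` and half keeps `κ = (1 + polyRate²)/2` below one. -/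
theorem exists_contraction_const {J : ℕ} {a : ℕ → ℝ} {lam : ℝ}
    (ha : ∀ j ∈ Icc 1 J, 0 ≤ a j) (hlam : 0 < lam) (hC₁ : 0 < C₁ J a lam) :
    ∃ ε κ : ℝ, 0 < ε ∧ κ < 1 ∧ lam * polyRate J a lam ^ 2 + 2 * ε ^ 2 ≤ lam * κ := by
  have hS0 : 0 ≤ polyRate J a lam := sum_nonneg (polyRate_term_nonneg ha hlam)
  have hS1 : polyRate J a lam < 1 := by
    have : 0 < √lam * (1 - polyRate J a lam) := hC₁
    linarith [pos_of_mul_pos_right this (Real.sqrt_nonneg lam)]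
  have hS2 : polyRate J a lam ^ 2 < 1 := pow_lt_one₀ hS0 hS1 two_ne_zero
  have hpos : 0 < lam * (1 - polyRate J a lam ^ 2) / 4 := by
    have := sub_pos.2 hS2
    positivity
  refine ⟨√(lam * (1 - polyRate J a lam ^ 2) / 4), (1 + polyRate J a lam ^ 2) / 2,
    Real.sqrt_pos.2 hpos, by linarith, le_of_eq ?_⟩
  rw [Real.sq_sqrt hpos.le]
  ring

theorem exists_bump_height {M m p C : ℝ} (hM : 0 < M) (hm : 0 < m) (hC : 0 < C) :
    ∃ s : ℝ, 0 < s ∧ 2 * s * M ≤ m ∧ (2 : ℝ) ^ (2 * p) * (8 * (s * M) ^ 2) ≤ C := by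
  have h2 : 0 < (2 : ℝ) ^ (2 * p) := Real.rpow_pos_of_pos two_pos _
  set w := min (m / 2) (√(C / (8 * (2 : ℝ) ^ (2 * p)))) with hw
  have hw0 : 0 < w := lt_min (by positivity) (Real.sqrt_pos.2 (by positivity))
  have hsM : w / M * M = w := div_mul_cancel₀ _ hM.ne'
  refine ⟨w / M, by positivity, ?_, ?_⟩
  · rw [mul_assoc, hsM]
    linarith [min_le_left (m / 2) (√(C / (8 * (2 : ℝ) ^ (2 * p))))]
  · rw [hsM]
    have h1 : w ^ 2 ≤ C / (8 * (2 : ℝ) ^ (2 * p)) := by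
      rw [← Real.sq_sqrt (by positivity : 0 ≤ C / (8 * (2 : ℝ) ^ (2 * p)))]
      exact pow_le_pow_left₀ hw0.le (min_le_right _ _) 2
    rw [le_div_iff₀ (by positivity)] at h1
    linarith

end McKeanVlasov

/-! ### Choice of constants and conclusion. -/

theorem mainTheorem1 (J : ℕ) (hJ : 1 ≤ J) (a : ℕ → ℝ) (ha : ∀ j ∈ Finset.Icc 1 J, 0 ≤ a j)
    (ha_one : 0 < a 1) (ha_top : 0 < a J) (p C C₀ lam : ℝ) (hp : 1 / 2 < p) (hC : 0 < C)
    (hC₀ : 0 < C₀) (hlam : 0 < lam) (hC₁ : 0 < McKeanVlasov.C₁ J a lam)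
    (hC₂ : 0 < McKeanVlasov.C₂ a lam) :
    ∃ c₀ : ℝ, 0 < c₀ ∧ ∃ δ : ℝ, 0 < δ ∧ ∀ N : ℕ, 2 ≤ N →
      ∀ est : (Fin N → ℝ) → ℝ → ℝ, Measurable (Function.uncurry est) →
        ∃ β : ℝ → ℝ, McKeanVlasov.InClass J a p C C₀ lam β ∧
          (∃! π : ℝ → ℝ,
            McKeanVlasov.IsInvariantDensity (McKeanVlasov.potential J a β) π) ∧
          ∀ π : ℝ → ℝ, McKeanVlasov.IsInvariantDensity (McKeanVlasov.potential J a β) π →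
            ENNReal.ofReal δ ≤
              MeasureTheory.Measure.pi (fun _ : Fin N => McKeanVlasov.law π)
                {Y : Fin N → ℝ |
                  ENNReal.ofReal (c₀ * Real.log (N : ℝ) ^ (-(p / (J : ℝ)))) <
                    MeasureTheory.eLpNorm (fun x => est Y x - deriv β x) 2
                      MeasureTheory.volume ^ 2} := by
  obtain ⟨ε₀, κ, hε₀, hκ, hεκ₀⟩ := McKeanVlasov.exists_contraction_const ha hlam hC₁
  -- A bump derivative below `ε` meets the class bound `C₁` and also leaves the contraction rate
  -- below one.
  set ε := min ε₀ (McKeanVlasov.C₁ J a lam) with hεdef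
  have hε : 0 < ε := lt_min hε₀ hC₁
  have hεκ : lam * McKeanVlasov.polyRate J a lam ^ 2 + 2 * ε ^ 2 ≤ lam * κ := by
    have : ε ^ 2 ≤ ε₀ ^ 2 := pow_le_pow_left₀ hε.le (min_le_left _ _) 2
    linarith
  obtain ⟨M, hM, hM0, hM1, hM2⟩ := McKeanVlasov.exists_bump_bound
  have hm : 0 < min C₀ (min ε (McKeanVlasov.C₂ a lam)) := lt_min hC₀ (lt_min hε hC₂)
  obtain ⟨s₀, hs₀, hs₀m, hs₀C⟩ := McKeanVlasov.exists_bump_height (p := p) hM hm hC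
  have hp0 : 0 < p := by linarith
  set I := ∫ y, deriv McKeanVlasov.bump y ^ 2 with hI
  have hIpos : 0 < I := McKeanVlasov.integral_sq_deriv_bump_pos
  set K := Real.exp (2 * C₀ + a J) * ∫ x, Real.exp (-(a J / 2) * x ^ 2) with hK
  have hK0 : 0 ≤ K := mul_nonneg (Real.exp_pos _).le (integral_nonneg fun _ => (Real.exp_pos _).le)
  set D := 12 * C₀ ^ 2 * K / (1 - κ) ^ 2 with hD
  have hD0 : 0 ≤ D := by positivity
  -- The rate `γ` anticipates `((R - 1)/2)^(2J) ≥ (R/4)^(2J)`, the tail exponent at half the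
  -- distance to the bumps.
  obtain ⟨A, hA, hAN⟩ := McKeanVlasov.exists_radius_const J
    (γ := a J / 2 / 4 ^ (2 * J)) (by positivity) hD0
  -- The factor `1/8` makes four times the threshold equal to half the lower bound for the
  -- separation, so the inequality is strict.
  refine ⟨s₀ ^ 2 * I * A ^ (-(p / J)) / 8, by positivity, 1 / 4, by norm_num, ?_⟩
  intro N hN est hest
  obtain ⟨hA4, hAH⟩ := hAN N hN
  have hlogN : 0 < Real.log N := Real.log_pos (by exact_mod_cast hN)
  have hJ0 : (J : ℝ) ≠ 0 := by positivity
  set R := (A * Real.log N) ^ (1 / (2 * J : ℝ)) with hR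
  have hAlog : 0 < A * Real.log N := by positivity
  have hRpow : R ^ (2 * J) = A * Real.log N := by
    rw [hR, ← Real.rpow_natCast, ← Real.rpow_mul hAlog.le]
    push_cast
    rw [one_div_mul_cancel (by positivity), Real.rpow_one]
  have hR0 : 0 < R := Real.rpow_pos_of_pos hAlog _
  have hR4 : 4 ≤ R := by
    rw [← hRpow] at hA4
    exact (pow_le_pow_iff_left₀ (by norm_num) hR0.le (by omega)).1 hA4
  have hRp1 : R ^ (-p) ≤ 1 := Real.rpow_le_one_of_one_le_of_nonpos (by linarith) (by linarith)
  have hRp0 : 0 < R ^ (-p) := Real.rpow_pos_of_pos hR0 _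
  set s := s₀ * R ^ (-p) with hs
  have hs0 : 0 ≤ s := by positivity
  have hsm : 2 * s * M ≤ min C₀ (min ε (McKeanVlasov.C₂ a lam)) := by
    refine le_trans ?_ hs₀m
    have : s ≤ s₀ := mul_le_of_le_one_right hs₀.le hRp1
    gcongr
  obtain ⟨hsC₀, hsεC₂⟩ := le_min_iff.1 hsm
  obtain ⟨hsε, hsC₂⟩ := le_min_iff.1 hsεC₂
  have P₀ : McKeanVlasov.Perturbation C₀ ε (McKeanVlasov.C₂ a lam) fun _ => 0 :=
    McKeanVlasov.perturbation_zero hC₀.le hε.le hC₂.le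
  have P₁ : McKeanVlasov.Perturbation C₀ ε (McKeanVlasov.C₂ a lam) (McKeanVlasov.twoBumps s R) :=
    McKeanVlasov.perturbation_twoBumps hs0 hM0 hM1 hM2 hsC₀ hsε hsC₂
  have F₀ := McKeanVlasov.confining_potential hJ ha P₀
  have F₁ := McKeanVlasov.confining_potential hJ ha P₁
  have T₀ := McKeanVlasov.contractive_potential hJ ha hlam P₀ hεκ
  have T₁ := McKeanVlasov.contractive_potential hJ ha hlam P₁ hεκ
  have U₀ := McKeanVlasov.existsUnique_isInvariantDensity F₀ hJ hlam T₀ hκ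
  have U₁ := McKeanVlasov.existsUnique_isInvariantDensity F₁ hJ hlam T₁ hκ
  have L₀ : McKeanVlasov.InClass J a p C C₀ lam fun _ => 0 :=
    McKeanVlasov.inClass_of_perturbation P₀ (min_le_right _ _)
      ⟨0, fun y => by simp⟩ fun y _ => by simp
  have L₁ : McKeanVlasov.InClass J a p C C₀ lam (McKeanVlasov.twoBumps s R) :=
    McKeanVlasov.inClass_of_perturbation P₁ (min_le_right _ _)
      ⟨2 * s * M, fun y => by
        rw [McKeanVlasov.iteratedDeriv_two_twoBumps]
        exact McKeanVlasov.abs_mul_add_le hs0 (hM2 _) (hM2 _)⟩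
      fun y hy => McKeanVlasov.rpow_mul_lintegral_deriv_twoBumps_le hs₀.le (by linarith) hp0 hM1
        hs₀C hy
  obtain ⟨π₀, hπ₀, -⟩ := id U₀
  obtain ⟨π₁, hπ₁, -⟩ := id U₁
  have hρ : 1 ≤ (R - 1) / 2 := by linarith
  set G := K * Real.exp (-(a J / 2) * ((R - 1) / 2) ^ (2 * J)) with hG
  have hhell : McKeanVlasov.hell π₀ π₁ ≤ 12 * C₀ ^ 2 * G / (1 - κ) ^ 2 := by
    refine McKeanVlasov.hell_le_tailMass (ρ := (R - 1) / 2) F₀ F₁ hJ hlam T₁ hκ (fun y => ?_)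
      (by linarith) (fun y hy => ?_) hπ₀ hπ₁
      (hπ₀.tailMass_le hJ ha ha_top P₀.bound_zero hρ)
      (hπ₁.tailMass_le hJ ha ha_top P₁.bound_zero hρ)
    · simpa [McKeanVlasov.potential] using P₁.bound_zero y
    · have := McKeanVlasov.twoBumps_eq_zero (s := s) (R := R) (y := y) (by linarith)
      simp [McKeanVlasov.potential, this]
  have hH : (N : ℝ) ^ 2 * McKeanVlasov.hell π₀ π₁ ≤ 1 / 4 := by
    refine le_trans (mul_le_mul_of_nonneg_left (hhell.trans ?_) (sq_nonneg _)) hAH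
    have hexp : Real.exp (-(a J / 2) * ((R - 1) / 2) ^ (2 * J)) ≤
        Real.exp (-(a J / 2 / 4 ^ (2 * J)) * (A * Real.log N)) := by
      rw [Real.exp_le_exp, ← hRpow]
      have h1 : (R / 4) ^ (2 * J) ≤ ((R - 1) / 2) ^ (2 * J) :=
        pow_le_pow_left₀ (by positivity) (by linarith) _
      rw [div_pow] at h1
      have h2 := mul_le_mul_of_nonneg_left h1 (half_pos ha_top).le
      have h3 : a J / 2 / 4 ^ (2 * J) * R ^ (2 * J) = a J / 2 * (R ^ (2 * J) / 4 ^ (2 * J)) := by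
        ring
      linarith
    calc 12 * C₀ ^ 2 * G / (1 - κ) ^ 2 =
          D * Real.exp (-(a J / 2) * ((R - 1) / 2) ^ (2 * J)) := by
          rw [hG, hD]
          ring
      _ ≤ _ := mul_le_mul_of_nonneg_left hexp hD0
  have hsep : 4 * ENNReal.ofReal (s₀ ^ 2 * I * A ^ (-(p / J)) / 8 * Real.log N ^ (-(p / (J : ℝ)))) <
      eLpNorm (fun x => deriv (McKeanVlasov.twoBumps s R) x - deriv (fun _ : ℝ => (0 : ℝ)) x) 2
        volume ^ 2 := by
    -- As `R` is the `2J`-th root of `A log N`, the squared height carries the rate `(log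
    -- N)^(-p/J)`.
    have hRsq : (R ^ (-p)) ^ 2 = A ^ (-(p / J)) * Real.log N ^ (-(p / (J : ℝ))) := by
      rw [← Real.mul_rpow hA.le hlogN.le, hR, ← Real.rpow_mul hAlog.le, ← Real.rpow_natCast,
        ← Real.rpow_mul hAlog.le]
      congr 1
      push_cast
      field_simp
    simp only [deriv_const, sub_zero]
    refine lt_of_lt_of_le ?_ (McKeanVlasov.ofReal_le_eLpNorm_deriv_twoBumps (by linarith))
    rw [← hI, hs, mul_pow, hRsq, show (4 : ℝ≥0∞) = ENNReal.ofReal 4 by simp,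
      ← ENNReal.ofReal_mul (by norm_num)]
    refine (ENNReal.ofReal_lt_ofReal_iff (by positivity)).2 ?_
    have : 0 < s₀ ^ 2 * I * A ^ (-(p / J)) * Real.log N ^ (-(p / (J : ℝ))) := by positivity
    linarith
  have hunion := McKeanVlasov.union_eq_univ_of_separated
    (measurable_deriv _).aestronglyMeasurable (measurable_deriv _).aestronglyMeasurable
    (fun Y => (hest.of_uncurry_left (x := Y)).aestronglyMeasurable) hsep
  rcases McKeanVlasov.quarter_le_law_pi hπ₀.nonneg hπ₁.nonneg hπ₀.integrable hπ₁.integrable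
    hπ₀.integral_eq_one hπ₁.integral_eq_one (by omega) hH hunion with h | h
  · exact ⟨_, L₀, U₀, fun π hπ => U₀.unique hπ₀ hπ ▸ h⟩
  · exact ⟨_, L₁, U₁, fun π hπ => U₁.unique hπ₁ hπ ▸ h⟩
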